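/- **Setting.** Consider the problem of minimizing $\varphi=\varphi_1+\varphi_2$ over $\mathbb R^p$, where $\varphi_1,\varphi_2:\mathbb R^p\to\mathbb R\cup\{\infty\}$. For $\gamma>0$ let $\operatorname{prox}_{\gamma h}(x)=\arg\min_w\{h(w)+\frac1{2\gamma}\|w-x\|^2\}$, let $\mathrm{DRS}_\gamma(s)$ be the set of pairs $(u,v)$ with $u\in\operatorname{prox}_{\gamma\varphi_1}(s)$ and $v\in\operatorname{prox}_{\gamma\varphi_2}(2u-s)$, and let $$\mathrm{DRE}_\gamma(s)=\varphi_1(u)+\varphi_2(v)+\tfrac1\gamma\langle s-u,v-u\rangle+\tfrac1{2\gamma}\|v-u\|^2,\qquad (u,v)\in\mathrm{DRS}_\gamma(s).$$ Let $\hat\partial h$ be the regular subdifferential, where $v\in\hat\partial h(x)$ iff $h(x)<\infty$ and $\liminf_{y\to x,\,y\ne x}\frac{h(y)-h(x)-\langle v,y-x\rangle}{\|y-x\|}\ge0$, and let $\partial h$ be the limiting subdifferential, where $v\in\partial h(x)$ iff $h(x)<\infty$ and there are $v^n\in\hat\partial h(x^n)$ with $(x^n,h(x^n),v^n)\to(x,h(x),v)$.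 For $\alpha\ge0$ and $\lambda\in(0,2)$ let $$C_\alpha(\lambda)=\tfrac{\lambda}{(1+\alpha)^2}\Bigl(\tfrac{2-\lambda}2-\alpha\,\kappa\Bigr),$$ where $\kappa=\max\{\alpha-\frac\lambda2,0\}$ in the convex version of the constant and $\kappa=1$ in the general version. Let $\lambda\in(0,2)$, $\varepsilon>0$, $c>0$, $\gamma>0$, $i_{\max}\in\mathbb N\cup\{\infty\}$, $s^0\in\mathbb R^p$, and assume one of the following. * *(Smooth setting; set $\pi=1$.)* $\varphi_1$ is real valued with $L$-Lipschitz gradient, $\varphi_2$ is lower semicontinuous, $\varphi$ has a minimizer at which it is finite; $\gamma<\frac1L$ if $\varphi_1$ is convex and $\gamma<\frac{2-\lambda}{2L}$ otherwise (with $\frac10=\infty$); and $c<C_{\gamma L}(\lambda)$, in the convex version if $\varphi_1$ is convex and in the general version otherwise. * *(Strongly convex setting; set $\pi=-1$.)* $\varphi_1$ is proper, lower semicontinuous and $\mu$-strongly convex with $\mu>0$, $\varphi_2$ is proper, lower semicontinuous and convex, $0\in\operatorname{relint}(\operatorname{dom}\varphi_1-\operatorname{dom}\varphi_2)$; $\gamma>\frac1\mu$;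 and $c<C_{1/(\gamma\mu)}(\lambda)$ in the convex version. **Algorithm.** Compute $(u^0,v^0)\in\mathrm{DRS}_\gamma(s^0)$. For $k=0,1,2,\dots$: 1. Put $r^k=u^k-v^k$. If $\frac1\gamma\|r^k\|\le\varepsilon$, return $(s^k,u^k,v^k)$. 2. Put $\bar s^{k+1}=s^k-\lambda r^k$, select any direction $d^k\in\mathbb R^p$, and set $\tau_k=1$, $i_k=0$. 3. Put $s^{k+1}=(1-\tau_k)\bar s^{k+1}+\tau_k(s^k+d^k)$ and compute $(u^{k+1},v^{k+1})\in\mathrm{DRS}_\gamma(s^{k+1})$. 4. If $\pi\,\mathrm{DRE}_\gamma(s^{k+1})\le\pi\,\mathrm{DRE}_\gamma(s^k)-\frac c\gamma\|r^k\|^2$, go on to the next $k$. Otherwise, if $i_k=i_{\max}$, set $s^{k+1}=\bar s^{k+1}$, compute $(u^{k+1},v^{k+1})\in\mathrm{DRS}_\gamma(s^{k+1})$ and go on to the next $k$. Otherwise replace $\tau_k$ by $\tau_k/2$ and $i_k$ by $i_k+1$ (a backtrack) and return to step 3. **Theorem.** The sets $\mathrm{DRS}_\gamma(s)$ are nonempty,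 the algorithm never gets stuck, $\mathrm{DRE}_\gamma$ is a well-defined real-valued function (independent of the choice of $(u,v)$), and $\min\varphi$ is attained and finite. For all choices of the directions $d^k$ and of the elements of the sets $\mathrm{DRS}_\gamma(\cdot)$: 1. At every iteration only finitely many backtracks are performed, whether $i_{\max}$ is finite or not. 2. The algorithm terminates, and it returns at an iteration $K$ with $$K\le\frac{|\mathrm{DRE}_\gamma(s^0)-\min\varphi|}{c\,\gamma\,\varepsilon^2}.$$ 3. In the smooth setting, $\hat\partial\varphi(v^K)\neq\emptyset$ and $\operatorname{dist}\bigl(0,\hat\partial\varphi(v^K)\bigr)\le2\varepsilon$. In the strongly convex setting, the triplet $(x,y,z)=\bigl(u^K,\frac1\gamma(u^K-s^K),v^K\bigr)$ satisfies $$-y\in\partial\varphi_1(x),\qquad \partial\varphi_2(z)\ne\emptyset,\quad \operatorname{dist}\bigl(y,\partial\varphi_2(z)\bigr)\le\varepsilon,\qquad\|x-z\|\le\gamma\varepsilon.$$ -/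

import Mathlib

open Filter Topology Set
open scoped Pointwise NNReal

noncomputable section

variable {E : Type*} [NormedAddCommGroup E] [InnerProductSpace ℝ E]

/-! ### Extended-real-valued functions

A function with values in `ℝ ∪ {∞}` is a function `h : E → EReal` with `∀ x, h x ≠ ⊥`. -/

/-- The domain `{x | h x < ∞}`. -/
def effDom (h : E → EReal) : Set E := {x | h x < ⊤}

/-- `h` takes its values in `ℝ ∪ {∞}` and is not identically `∞`. -/
def IsProper (h : E → EReal) : Prop := (∀ x, h x ≠ ⊥) ∧ (effDom h).Nonempty

/-- Convexity (Jensen's inequality) of a function with values in `ℝ ∪ {∞}`. -/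
def ExtConvex (h : E → EReal) : Prop :=
  ∀ x y : E, ∀ a b : ℝ, 0 ≤ a → 0 ≤ b → a + b = 1 →
    h (a • x + b • y) ≤ (a : EReal) * h x + (b : EReal) * h y

/-- `μ`-strong convexity: `h - (μ/2) ‖·‖²` is convex. -/
def ExtStronglyConvex (μ : ℝ) (h : E → EReal) : Prop :=
  ExtConvex fun x => h x - ((μ / 2 * ‖x‖ ^ 2 : ℝ) : EReal)

/-- The set of minimizers, which by convention is empty if `h` is identically `∞`. -/
def argminSet (h : E → EReal) : Set E := {x | h x < ⊤ ∧ ∀ y, h x ≤ h y}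

/-- The (set-valued) proximal mapping of `h` with stepsize `γ`. -/
def proxSet (γ : ℝ) (h : E → EReal) (x : E) : Set E :=
  argminSet fun w => h w + ((1 / (2 * γ) * ‖w - x‖ ^ 2 : ℝ) : EReal)

/-- The regular subdifferential of `h` at `x` (empty outside of the domain). -/
def regSubdiff (h : E → EReal) (x : E) : Set E :=
  {v | x ∈ effDom h ∧
    0 ≤ liminf (fun y => (h y - h x - ((inner ℝ v (y - x) : ℝ) : EReal)) / ((‖y - x‖ : ℝ) : EReal))
      (𝓝[≠] x)}

/-- The limiting subdifferential of `h` at `x`. -/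
def limSubdiff (h : E → EReal) (x : E) : Set E :=
  {v | x ∈ effDom h ∧ ∃ xs vs : ℕ → E, (∀ n, vs n ∈ regSubdiff h (xs n)) ∧
    Tendsto xs atTop (𝓝 x) ∧ Tendsto (fun n => h (xs n)) atTop (𝓝 (h x)) ∧
    Tendsto vs atTop (𝓝 v)}

/-! ### Douglas-Rachford splitting -/

/-- The set of possible results `(u, v)` of one Douglas-Rachford update at `s`. -/
def drsOracle (γ : ℝ) (φ₁ φ₂ : E → EReal) (s : E) : Set (E × E) :=
  {q | q.1 ∈ proxSet γ φ₁ s ∧ q.2 ∈ proxSet γ φ₂ ((2 : ℝ) • q.1 - s)}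

/-- The Douglas-Rachford envelope at `s`, evaluated with the result `(u, v)` of an update at `s`. -/
def dreValue (γ : ℝ) (φ₁ φ₂ : E → EReal) (s u v : E) : EReal :=
  φ₁ u + φ₂ v + ((1 / γ * inner ℝ (s - u) (v - u) + 1 / (2 * γ) * ‖v - u‖ ^ 2 : ℝ) : EReal)

open Classical in
/-- The decrease constant `C_α(λ)`; `convex` says whether the smooth function is convex. -/
def decreaseConst (convex : Prop) (α lam : ℝ) : ℝ :=
  lam / (1 + α) ^ 2 * ((2 - lam) / 2 - α * (if convex then max (α - lam / 2) 0 else 1))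

/-- The smooth setting: `φ₁` is real valued with `L`-Lipschitz gradient, `φ₂` is lsc with values in
`ℝ ∪ {∞}`, and `φ₁ + φ₂` has a minimizer. -/
structure SmoothSetting [CompleteSpace E] (φ₁ φ₂ : E → EReal) (L : ℝ≥0) : Prop where
  smooth : ∃ f : E → ℝ, (∀ x, φ₁ x = (f x : EReal)) ∧ Differentiable ℝ f ∧
    LipschitzWith L (gradient f)
  ne_bot : ∀ x, φ₂ x ≠ ⊥
  lsc : LowerSemicontinuous φ₂
  solvable : (argminSet fun x => φ₁ x + φ₂ x).Nonempty

/-- The strongly convex setting. -/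
structure StronglyConvexSetting (φ₁ φ₂ : E → EReal) (μ : ℝ) : Prop where
  proper₁ : IsProper φ₁
  lsc₁ : LowerSemicontinuous φ₁
  pos : 0 < μ
  strong : ExtStronglyConvex μ φ₁
  proper₂ : IsProper φ₂
  lsc₂ : LowerSemicontinuous φ₂
  convex₂ : ExtConvex φ₂
  relint : (0 : E) ∈ intrinsicInterior ℝ (effDom φ₁ - effDom φ₂)

/-! ### The linesearch algorithm as a transition system -/

/-- The numbers that the algorithm is run with: stepsize `γ`, relaxation `lam`, decrease constant
`c`, tolerance `ε`, sign `π`, and maximal number of backtracks `imax ≤ ∞`. -/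
structure LSParams where
  γ : ℝ
  lam : ℝ
  c : ℝ
  ε : ℝ
  π : ℝ
  imax : ℕ∞

/-- The requirements on the parameters that are common to both settings. -/
structure LSParams.Admissible (P : LSParams) : Prop where
  γ_pos : 0 < P.γ
  lam_pos : 0 < P.lam
  lam_lt : P.lam < 2
  c_pos : 0 < P.c
  ε_pos : 0 < P.ε

open Classical in
/-- Initialization in the smooth setting. The bound on the stepsize is `γ < 1 / L` if `φ₁` is convex
and `γ < (2 - λ) / (2 L)` otherwise, where `1 / 0 = ∞`. -/
structure LSParams.SmoothInit [CompleteSpace E] (P : LSParams) (φ₁ φ₂ : E → EReal) (L : ℝ≥0) :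
    Prop where
  setting : SmoothSetting φ₁ φ₂ L
  sign : P.π = 1
  stepsize : P.γ * L < if ExtConvex φ₁ then 1 else (2 - P.lam) / 2
  c_lt : P.c < decreaseConst (ExtConvex φ₁) (P.γ * L) P.lam

/-- Initialization in the strongly convex setting, where the decrease constant is the one of the
dual problem: a convex function with `1 / μ`-Lipschitz gradient, and stepsize `1 / γ`. -/
structure LSParams.StronglyConvexInit (P : LSParams) (φ₁ φ₂ : E → EReal) (μ : ℝ) : Prop where
  setting : StronglyConvexSetting φ₁ φ₂ μ
  sign : P.π = -1
  stepsize : 1 / μ < P.γ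
  c_lt : P.c < decreaseConst True (1 / (P.γ * μ)) P.lam

/-- Control states of the algorithm.
* `outer k s u v`: beginning of iteration `k`, with `(sᵏ, uᵏ, vᵏ) = (s, u, v)`;
* `trial k s u v d τ i`: the direction `d = dᵏ` is selected, and after `i` backtracks the candidate
  update with `τₖ = τ` is about to be tested;
* `done k s u v`: the algorithm has returned `(s, u, v)` at iteration `k`. -/
inductive LSState (E : Type*) where
  | outer (k : ℕ) (s u v : E)
  | trial (k : ℕ) (s u v d : E) (τ : ℝ) (i : ℕ)
  | done (k : ℕ) (s u v : E)

/-- The nominal update `s - λ (u - v)`. -/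
def nominalStep (lam : ℝ) (s u v : E) : E := s - lam • (u - v)

/-- The candidate update `(1 - τ) (s - λ (u - v)) + τ (s + d)`. -/
def candidateStep (lam : ℝ) (s u v d : E) (τ : ℝ) : E :=
  (1 - τ) • nominalStep lam s u v + τ • (s + d)

/-- The linesearch test at `(s, u, v)` for a candidate `(s', u', v')`. -/
def LSTest (P : LSParams) (φ₁ φ₂ : E → EReal) (s u v s' u' v' : E) : Prop :=
  (P.π : EReal) * dreValue P.γ φ₁ φ₂ s' u' v' ≤
    (P.π : EReal) * dreValue P.γ φ₁ φ₂ s u v - ((P.c / P.γ * ‖u - v‖ ^ 2 : ℝ) : EReal)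

/-- The elementary steps of the algorithm. The direction `d` and the results of the oracle calls are
arbitrary. -/
inductive LSStep (P : LSParams) (φ₁ φ₂ : E → EReal) : LSState E → LSState E → Prop
  | finish {k : ℕ} {s u v : E} (h : 1 / P.γ * ‖u - v‖ ≤ P.ε) :
      LSStep P φ₁ φ₂ (.outer k s u v) (.done k s u v)
  | select {k : ℕ} {s u v : E} (h : ¬ 1 / P.γ * ‖u - v‖ ≤ P.ε) (d : E) :
      LSStep P φ₁ φ₂ (.outer k s u v) (.trial k s u v d 1 0)
  | accept {k : ℕ} {s u v d : E} {τ : ℝ} {i : ℕ} {s' u' v' : E}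
      (hs : s' = candidateStep P.lam s u v d τ)
      (huv : (u', v') ∈ drsOracle P.γ φ₁ φ₂ s')
      (htest : LSTest P φ₁ φ₂ s u v s' u' v') :
      LSStep P φ₁ φ₂ (.trial k s u v d τ i) (.outer (k + 1) s' u' v')
  | nominal {k : ℕ} {s u v d : E} {τ : ℝ} {i : ℕ} {s' u' v' sbar ubar vbar : E}
      (hs : s' = candidateStep P.lam s u v d τ)
      (huv : (u', v') ∈ drsOracle P.γ φ₁ φ₂ s')
      (htest : ¬ LSTest P φ₁ φ₂ s u v s' u' v')
      (hi : (i : ℕ∞) = P.imax)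
      (hsbar : sbar = nominalStep P.lam s u v)
      (hbar : (ubar, vbar) ∈ drsOracle P.γ φ₁ φ₂ sbar) :
      LSStep P φ₁ φ₂ (.trial k s u v d τ i) (.outer (k + 1) sbar ubar vbar)
  | backtrack {k : ℕ} {s u v d : E} {τ : ℝ} {i : ℕ} {s' u' v' : E}
      (hs : s' = candidateStep P.lam s u v d τ)
      (huv : (u', v') ∈ drsOracle P.γ φ₁ φ₂ s')
      (htest : ¬ LSTest P φ₁ φ₂ s u v s' u' v')
      (hi : (i : ℕ∞) ≠ P.imax) :
      LSStep P φ₁ φ₂ (.trial k s u v d τ i) (.trial k s u v d (τ / 2) (i + 1))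

/-- The initial states: `(u⁰, v⁰)` is any result of an update at `s⁰`. -/
def LSInit (P : LSParams) (φ₁ φ₂ : E → EReal) (s₀ : E) (σ : LSState E) : Prop :=
  ∃ u v : E, (u, v) ∈ drsOracle P.γ φ₁ φ₂ s₀ ∧ σ = .outer 0 s₀ u v

/-- The states that the algorithm started at `s⁰` can reach. -/
def LSReachable (P : LSParams) (φ₁ φ₂ : E → EReal) (s₀ : E) (σ : LSState E) : Prop :=
  ∃ σ₀, LSInit P φ₁ φ₂ s₀ σ₀ ∧ Relation.ReflTransGen (LSStep P φ₁ φ₂) σ₀ σ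

end

/-! In both settings the function `ψ = π · DRE` is a merit function: it is real valued, upper
semicontinuous and bounded below by `π · min φ`, and a nominal step decreases it by `C/γ ‖u - v‖²`
with `C > c`. These facts suffice for the algorithm. As long as it runs, `‖u - v‖ > γε`, so every
completed iteration costs at least `cγε²` of merit, and the number of iterations is bounded. As `τ →
0` the candidates tend to the nominal step, where the test holds strictly; upper semicontinuity
makes it hold for all small `τ`. The fallback after `imax` backtracks is the nominal step itself.

For two updates put `r = u - v`, `δ = u' - u` and `G = (s' - u') - (s - u)`, so that `δ + G = s' -
s`. Comparing `v'` with `v` in the proximal problem of `φ₂` at `s'` bounds `γ (DRE(s') - DRE(s))`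
from above by `-D + ⟪r, δ - G⟫ + ½‖δ‖²`, with a Bregman term `D` of `φ₁` (`mul_dreReal_sub_le`). If
`φ₂` is convex, its subgradient inequality at `v` gives the lower bound `D + ⟪r, δ - G⟫ - ½‖G‖²`,
with the base point of `D` exchanged (`le_mul_dreReal_sub`). At a nominal step `δ + G = -λr`, which
turns the inner product into a difference of squares.

Both decrease estimates then become the same quadratic inequality `decreaseConst_mul_norm_sq_le`. In
the smooth setting `G` is controlled by `δ`, since `s - u = γ∇φ₁(u)`; in the strongly convex setting
`δ` is controlled by `G`, through strong monotonicity. This exchange replaces passing to the dual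
problem. The bounds on the output are the optimality conditions of the two proximal problems. -/

/-! ### The linesearch algorithm with an abstract merit function -/

/-- A real-valued merit function that is bounded below by `b`, that is evaluated by the oracle, and
that decreases by more than the linesearch demands along nominal steps. -/
structure MeritFunction {E : Type*} [NormedAddCommGroup E] [InnerProductSpace ℝ E]
    (P : LSParams) (φ₁ φ₂ : E → EReal) (ψ : E → ℝ) (b : ℝ) : Prop where
  nonempty : ∀ s, (drsOracle P.γ φ₁ φ₂ s).Nonempty
  value : ∀ s u v, (u, v) ∈ drsOracle P.γ φ₁ φ₂ s →
    (P.π : EReal) * dreValue P.γ φ₁ φ₂ s u v = (ψ s : EReal)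
  decrease : ∀ s u v, (u, v) ∈ drsOracle P.γ φ₁ φ₂ s →
    ∃ C, P.c < C ∧ ψ (nominalStep P.lam s u v) ≤ ψ s - C / P.γ * ‖u - v‖ ^ 2
  usc : UpperSemicontinuous ψ
  lower : ∀ s, b ≤ ψ s

/-- What holds in the reachable states of the algorithm. -/
def LSInvariant {E : Type*} [NormedAddCommGroup E] [InnerProductSpace ℝ E]
    (P : LSParams) (φ₁ φ₂ : E → EReal) (ψ : E → ℝ) (s₀ : E) : LSState E → Prop
  | .outer k s u v => (u, v) ∈ drsOracle P.γ φ₁ φ₂ s ∧ ψ s + k * (P.c * P.γ * P.ε ^ 2) ≤ ψ s₀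
  | .trial k s u v _ _ _ => ((u, v) ∈ drsOracle P.γ φ₁ φ₂ s ∧
      ψ s + k * (P.c * P.γ * P.ε ^ 2) ≤ ψ s₀) ∧ ¬ 1 / P.γ * ‖u - v‖ ≤ P.ε
  | .done k s u v => ((u, v) ∈ drsOracle P.γ φ₁ φ₂ s ∧
      ψ s + k * (P.c * P.γ * P.ε ^ 2) ≤ ψ s₀) ∧ 1 / P.γ * ‖u - v‖ ≤ P.ε

namespace MeritFunction

variable {E : Type*} [NormedAddCommGroup E] [InnerProductSpace ℝ E]
  {P : LSParams} {φ₁ φ₂ : E → EReal} {ψ : E → ℝ} {b : ℝ}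

theorem lsTest_iff (M : MeritFunction P φ₁ φ₂ ψ b) {s u v s' u' v' : E}
    (h : (u, v) ∈ drsOracle P.γ φ₁ φ₂ s) (h' : (u', v') ∈ drsOracle P.γ φ₁ φ₂ s') :
    LSTest P φ₁ φ₂ s u v s' u' v' ↔ ψ s' ≤ ψ s - P.c / P.γ * ‖u - v‖ ^ 2 := by
  rw [LSTest, M.value _ _ _ h, M.value _ _ _ h']
  exact_mod_cast Iff.rfl

theorem nominal_le (M : MeritFunction P φ₁ φ₂ ψ b) (hP : P.Admissible) {s u v : E}
    (h : (u, v) ∈ drsOracle P.γ φ₁ φ₂ s) :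
    ψ (nominalStep P.lam s u v) ≤ ψ s - P.c / P.γ * ‖u - v‖ ^ 2 := by
  obtain ⟨C, hC, hle⟩ := M.decrease s u v h
  have hγ := hP.γ_pos
  have : P.c / P.γ * ‖u - v‖ ^ 2 ≤ C / P.γ * ‖u - v‖ ^ 2 := by gcongr
  linarith

/-- The failed stopping test says that the residual exceeds `γε`, so the demanded decrease `c/γ ·
r²` is at least `cγε²`, a fixed charge per iteration. -/
theorem budget_step (hP : P.Admissible) {a a' a₀ r : ℝ} {k : ℕ}
    (hk : a + k * (P.c * P.γ * P.ε ^ 2) ≤ a₀) (hr : ¬ 1 / P.γ * r ≤ P.ε)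
    (ha' : a' ≤ a - P.c / P.γ * r ^ 2) :
    a' + (k + 1 : ℕ) * (P.c * P.γ * P.ε ^ 2) ≤ a₀ := by
  have hγ := hP.γ_pos
  have hc := hP.c_pos
  have hε := hP.ε_pos
  have h1 : P.γ * P.ε ≤ r := by
    rw [not_le, one_div, lt_inv_mul_iff₀ hγ] at hr
    exact hr.le
  have h2 : P.c * P.γ * P.ε ^ 2 ≤ P.c / P.γ * r ^ 2 := by
    calc P.c * P.γ * P.ε ^ 2 = P.c / P.γ * (P.γ * P.ε) ^ 2 := by field_simp
      _ ≤ _ := by gcongr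
  push_cast
  linarith

theorem invariant_step (M : MeritFunction P φ₁ φ₂ ψ b) (hP : P.Admissible) {s₀ : E}
    {σ σ' : LSState E} (hσ : LSInvariant P φ₁ φ₂ ψ s₀ σ) (hstep : LSStep P φ₁ φ₂ σ σ') :
    LSInvariant P φ₁ φ₂ ψ s₀ σ' := by
  cases hstep with
  | finish h => exact ⟨hσ, h⟩
  | select h d => exact ⟨hσ, h⟩
  | accept hs huv htest =>
    obtain ⟨⟨h1, h2⟩, h3⟩ := hσ
    exact ⟨huv, budget_step hP h2 h3 ((M.lsTest_iff h1 huv).1 htest)⟩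
  | nominal hs huv htest hi hsbar hbar =>
    obtain ⟨⟨h1, h2⟩, h3⟩ := hσ
    exact ⟨hbar, budget_step hP h2 h3 (hsbar ▸ M.nominal_le hP h1)⟩
  | backtrack hs huv htest hi => exact hσ

theorem invariant_of_reachable (M : MeritFunction P φ₁ φ₂ ψ b) (hP : P.Admissible) {s₀ : E}
    {σ : LSState E} (hσ : LSReachable P φ₁ φ₂ s₀ σ) : LSInvariant P φ₁ φ₂ ψ s₀ σ := by
  obtain ⟨σ₀, ⟨u, v, huv, rfl⟩, hr⟩ := hσ
  induction hr with
  | refl => exact ⟨huv, by simp⟩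
  | tail _ hstep ih => exact M.invariant_step hP ih hstep

theorem iterations_le (M : MeritFunction P φ₁ φ₂ ψ b) (hP : P.Admissible) {s s₀ : E} {k : ℕ}
    (hk : ψ s + k * (P.c * P.γ * P.ε ^ 2) ≤ ψ s₀) :
    (k : ℝ) ≤ (ψ s₀ - b) / (P.c * P.γ * P.ε ^ 2) := by
  have hγ := hP.γ_pos
  have hc := hP.c_pos
  have hε := hP.ε_pos
  rw [le_div_iff₀ (by positivity)]
  linarith [M.lower s]

/-- The nominal step passes the test strictly, because `C > c` and the residual is nonzero, and the
candidates converge to it. The threshold `N` serves all oracle results at once, since the merit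
value depends on `s` alone. -/
theorem exists_lsTest (M : MeritFunction P φ₁ φ₂ ψ b) (hP : P.Admissible) {s u v : E} (d : E)
    (h : (u, v) ∈ drsOracle P.γ φ₁ φ₂ s) (hr : ¬ 1 / P.γ * ‖u - v‖ ≤ P.ε) :
    ∃ N : ℕ, ∀ i, N ≤ i → ∀ s' u' v', s' = candidateStep P.lam s u v d ((1 / 2) ^ i) →
      (u', v') ∈ drsOracle P.γ φ₁ φ₂ s' → LSTest P φ₁ φ₂ s u v s' u' v' := by
  have hγ := hP.γ_pos
  obtain ⟨C, hC, hle⟩ := M.decrease s u v h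
  have hpos : 0 < ‖u - v‖ := by
    by_contra hn
    have h0 : ‖u - v‖ = 0 := le_antisymm (not_lt.1 hn) (norm_nonneg _)
    exact hr (by simpa [h0] using hP.ε_pos.le)
  have hlt : ψ (nominalStep P.lam s u v) < ψ s - P.c / P.γ * ‖u - v‖ ^ 2 := by
    have : P.c / P.γ * ‖u - v‖ ^ 2 < C / P.γ * ‖u - v‖ ^ 2 := by gcongr
    linarith
  have hlim : Tendsto (fun i : ℕ => candidateStep P.lam s u v d ((1 / 2) ^ i)) atTop
      (𝓝 (nominalStep P.lam s u v)) := by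
    have hτ : Tendsto (fun i : ℕ => (1 / 2 : ℝ) ^ i) atTop (𝓝 0) :=
      tendsto_pow_atTop_nhds_zero_of_lt_one (by norm_num) (by norm_num)
    have := ((tendsto_const_nhds (x := (1 : ℝ))).sub hτ).smul_const (nominalStep P.lam s u v)
    simpa [candidateStep] using this.add (hτ.smul_const (s + d))
  obtain ⟨N, hN⟩ := eventually_atTop.1 (hlim.eventually (M.usc _ _ hlt))
  refine ⟨N, fun i hi s' u' v' hs' huv => (M.lsTest_iff h huv).2 ?_⟩
  rw [hs']
  exact (hN i hi).le

theorem exists_step (M : MeritFunction P φ₁ φ₂ ψ b) (σ : LSState E) :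
    (∃ σ', LSStep P φ₁ φ₂ σ σ') ∨ ∃ K s u v, σ = .done K s u v := by
  cases σ with
  | outer k s u v =>
    left
    by_cases h : 1 / P.γ * ‖u - v‖ ≤ P.ε
    · exact ⟨_, .finish h⟩
    · exact ⟨_, .select h 0⟩
  | trial k s u v d τ i =>
    left
    obtain ⟨⟨u', v'⟩, huv⟩ := M.nonempty (candidateStep P.lam s u v d τ)
    obtain ⟨⟨ubar, vbar⟩, hbar⟩ := M.nonempty (nominalStep P.lam s u v)
    by_cases htest : LSTest P φ₁ φ₂ s u v (candidateStep P.lam s u v d τ) u' v'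
    · exact ⟨_, .accept rfl huv htest⟩
    · by_cases hi : (i : ℕ∞) = P.imax
      · exact ⟨_, .nominal rfl huv htest hi rfl hbar⟩
      · exact ⟨_, .backtrack rfl huv htest hi⟩
  | done k s u v => exact Or.inr ⟨k, s, u, v, rfl⟩

theorem backtracks_le (M : MeritFunction P φ₁ φ₂ ψ b) (hP : P.Admissible) {k : ℕ} {s u v : E}
    (d : E) (h : (u, v) ∈ drsOracle P.γ φ₁ φ₂ s) (hr : ¬ 1 / P.γ * ‖u - v‖ ≤ P.ε) :
    ∃ N : ℕ, ∀ τ i, Relation.ReflTransGen (LSStep P φ₁ φ₂)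
      (.trial k s u v d 1 0) (.trial k s u v d τ i) → i ≤ N := by
  obtain ⟨N, hN⟩ := M.exists_lsTest hP d h hr
  -- Leaving the loop raises the iteration counter for good, so a trial state that still has counter
  -- `k` belongs to the original loop. A failed test at `i` forces `i < N`, hence `i + 1 ≤ N` after
  -- the backtrack.
  have key : ∀ σ, Relation.ReflTransGen (LSStep P φ₁ φ₂) (.trial k s u v d 1 0) σ →
      match σ with
      | .outer k' _ _ _ => k < k'
      | .trial k' s' u' v' d' τ i => k < k' ∨
          (k' = k ∧ s' = s ∧ u' = u ∧ v' = v ∧ d' = d ∧ τ = (1 / 2) ^ i ∧ i ≤ N)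
      | .done k' _ _ _ => k < k' := by
    intro σ hσ
    induction hσ with
    | refl => exact Or.inr ⟨rfl, rfl, rfl, rfl, rfl, by simp, Nat.zero_le _⟩
    | tail _ hstep ih =>
      cases hstep with
      | finish _ => exact ih
      | select _ _ => exact Or.inl ih
      | accept => exact Nat.lt_succ_of_le (ih.elim le_of_lt fun h => h.1.ge)
      | nominal => exact Nat.lt_succ_of_le (ih.elim le_of_lt fun h => h.1.ge)
      | backtrack hs huv htest hi =>
        rcases ih with hlt | ⟨rfl, rfl, rfl, rfl, rfl, rfl, hi'⟩
        · exact Or.inl hlt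
        · refine Or.inr ⟨rfl, rfl, rfl, rfl, rfl, by rw [pow_succ]; ring, ?_⟩
          by_contra hlt
          exact htest (hN _ (by omega) _ _ _ hs huv)
  refine ⟨N, fun τ i hσ => ?_⟩
  rcases key _ hσ with hlt | ⟨-, -, -, -, -, -, hi⟩
  · exact absurd hlt (lt_irrefl k)
  · exact hi

/-- Lexicographic descent over all choices of directions and oracle results: `n` bounds the
remaining iterations, and the inner induction on `j` bounds the backtracks left before the threshold
`N`. For `n = 0` the iteration bound is already violated. -/
theorem acc_outer (M : MeritFunction P φ₁ φ₂ ψ b) (hP : P.Admissible) {s₀ : E} (n : ℕ) :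
    ∀ (k : ℕ) (s u v : E), LSInvariant P φ₁ φ₂ ψ s₀ (.outer k s u v) →
      (ψ s₀ - b) / (P.c * P.γ * P.ε ^ 2) < k + n →
      Acc (fun σ' σ => LSStep P φ₁ φ₂ σ σ') (.outer k s u v) := by
  induction n with
  | zero =>
    intro k s u v hinv hlt
    have := M.iterations_le hP hinv.2
    simp only [Nat.cast_zero, add_zero] at hlt
    linarith
  | succ n ih =>
    intro k s u v hinv hlt
    have hlt' : (ψ s₀ - b) / (P.c * P.γ * P.ε ^ 2) < (k + 1 : ℕ) + n := by
      push_cast at hlt ⊢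
      linarith
    refine Acc.intro _ fun σ' hstep => ?_
    cases hstep with
    | finish h => exact Acc.intro _ fun σ'' h' => by cases h'
    | select hr d =>
      obtain ⟨N, hN⟩ := M.exists_lsTest hP d hinv.1 hr
      have key : ∀ j i : ℕ, N ≤ i + j → Acc (fun σ' σ => LSStep P φ₁ φ₂ σ σ')
          (.trial k s u v d ((1 / 2) ^ i) i) := by
        intro j
        induction j with
        | zero =>
          intro i hi
          refine Acc.intro _ fun σ' hstep => ?_
          have hinv' := M.invariant_step hP (σ := .trial k s u v d ((1 / 2) ^ i) i) ⟨hinv, hr⟩ hstep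
          cases hstep with
          | accept => exact ih _ _ _ _ hinv' hlt'
          | nominal => exact ih _ _ _ _ hinv' hlt'
          | backtrack hs huv htest _ => exact absurd (hN i hi _ _ _ hs huv) htest
        | succ j ihj =>
          intro i hi
          refine Acc.intro _ fun σ' hstep => ?_
          have hinv' := M.invariant_step hP (σ := .trial k s u v d ((1 / 2) ^ i) i) ⟨hinv, hr⟩ hstep
          cases hstep with
          | accept => exact ih _ _ _ _ hinv' hlt'
          | nominal => exact ih _ _ _ _ hinv' hlt'
          | backtrack =>
            have := ihj (i + 1) (by omega)
            rwa [pow_succ, mul_one_div] at this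
      simpa using key N 0 (by omega)

theorem terminates (M : MeritFunction P φ₁ φ₂ ψ b) (hP : P.Admissible) (s₀ : E) :
    ¬ ∃ σ : ℕ → LSState E,
      LSInit P φ₁ φ₂ s₀ (σ 0) ∧ ∀ n, LSStep P φ₁ φ₂ (σ n) (σ (n + 1)) := by
  rintro ⟨σ, ⟨u, v, huv, h0⟩, hσ⟩
  obtain ⟨n, hn⟩ := exists_nat_gt ((ψ s₀ - b) / (P.c * P.γ * P.ε ^ 2))
  have hacc := M.acc_outer hP (s₀ := s₀) n 0 s₀ u v ⟨huv, by simp⟩ (by simpa using hn)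
  rw [← h0] at hacc
  exact not_acc_iff_exists_descending_chain.2 ⟨σ, rfl, hσ⟩ hacc

end MeritFunction

/-! ### Extended-real-valued functions, proximal points and subgradients -/

section ExtendedReal

variable {E : Type*} [NormedAddCommGroup E] [InnerProductSpace ℝ E]

theorem EReal.exists_coe_of_ne_bot_of_lt_top {x : EReal} (hb : x ≠ ⊥) (ht : x < ⊤) :
    ∃ a : ℝ, x = (a : EReal) :=
  ⟨x.toReal, (EReal.coe_toReal ht.ne hb).symm⟩

theorem EReal.coe_le_of_forall_coe {a : ℝ} {x : EReal} (hb : x ≠ ⊥)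
    (h : ∀ b : ℝ, x = (b : EReal) → a ≤ b) : (a : EReal) ≤ x := by
  induction x with
  | bot => exact absurd rfl hb
  | coe b => exact_mod_cast h b rfl
  | top => exact le_top

theorem lowerSemicontinuous_add_of_ne_bot {X : Type*} [TopologicalSpace X]
    {g h : X → EReal} (hg : LowerSemicontinuous g)
    (hh : LowerSemicontinuous h) (hgb : ∀ x, g x ≠ ⊥) (hhb : ∀ x, h x ≠ ⊥) :
    LowerSemicontinuous fun x => g x + h x :=
  hg.add' hh fun x => EReal.continuousAt_add (Or.inr (hhb x)) (Or.inl (hgb x))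

theorem lowerSemicontinuous_coe {X : Type*} [TopologicalSpace X]
    {q : X → ℝ} (hq : Continuous q) :
    LowerSemicontinuous fun x => (q x : EReal) :=
  (continuous_coe_real_ereal.comp hq).lowerSemicontinuous

/-- The difference quotient is at least `-C ‖y - x‖`, which tends to `0`; where `h y = ⊤` the
quotient is `⊤`. -/
theorem mem_regSubdiff_of_quadratic_minorant {h : E → EReal} {x v : E} {a : ℝ}
    (hx : h x = (a : EReal)) (C : ℝ)
    (H : ∀ y, ((a + inner ℝ v (y - x) - C * ‖y - x‖ ^ 2 : ℝ) : EReal) ≤ h y) :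
    v ∈ regSubdiff h x := by
  refine ⟨by simp [effDom, hx], le_of_forall_lt fun c hc => ?_⟩
  obtain ⟨c', hcc', hc'⟩ := exists_between hc
  refine lt_of_lt_of_le hcc' ?_
  refine le_liminf_of_le (by isBoundedDefault) ?_
  have hcont : Tendsto (fun y => ((-C * ‖y - x‖ : ℝ) : EReal)) (𝓝[≠] x) (𝓝 0) := by
    have : Continuous fun y => ((-C * ‖y - x‖ : ℝ) : EReal) :=
      continuous_coe_real_ereal.comp (by fun_prop)
    simpa using (this.tendsto x).mono_left nhdsWithin_le_nhds
  filter_upwards [hcont.eventually (lt_mem_nhds hc'), self_mem_nhdsWithin] with y hy hne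
  refine hy.le.trans ?_
  have hpos : 0 < ‖y - x‖ := norm_pos_iff.2 (sub_ne_zero.2 hne)
  have hHy := H y
  rw [hx]
  generalize h y = hyv at hHy
  induction hyv with
  | bot => exact absurd (le_bot_iff.1 hHy) (EReal.coe_ne_bot _)
  | coe b =>
    rw [← EReal.coe_sub, ← EReal.coe_sub, ← EReal.coe_div]
    have hb : a + inner ℝ v (y - x) - C * ‖y - x‖ ^ 2 ≤ b := by exact_mod_cast hHy
    have : -C * ‖y - x‖ ≤ (b - a - inner ℝ v (y - x)) / ‖y - x‖ := by
      rw [le_div_iff₀ hpos]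
      nlinarith
    exact_mod_cast this
  | top =>
    rw [EReal.top_sub_coe, EReal.top_sub_coe,
      EReal.top_div_of_pos_ne_top (by exact_mod_cast hpos) (EReal.coe_ne_top _)]
    exact le_top

theorem regSubdiff_subset_limSubdiff (h : E → EReal) (x : E) :
    regSubdiff h x ⊆ limSubdiff h x := fun v hv =>
  ⟨hv.1, fun _ => x, fun _ => v, fun _ => hv, tendsto_const_nhds, tendsto_const_nhds,
    tendsto_const_nhds⟩

/-! ### Proximal points without convexity -/

theorem exists_coe_of_mem_proxSet {E : Type*} [NormedAddCommGroup E] {h : E → EReal} (hb : ∀ x, h x ≠ ⊥) {γ : ℝ} {s u : E}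
    (hu : u ∈ proxSet γ h s) : ∃ a : ℝ, h u = (a : EReal) := by
  refine EReal.exists_coe_of_ne_bot_of_lt_top (hb u) (lt_top_iff_ne_top.2 fun ht => ?_)
  have := hu.1
  simp only [ht, EReal.top_add_coe, lt_self_iff_false] at this

theorem le_of_mem_proxSet {E : Type*} [NormedAddCommGroup E] {h : E → EReal} {γ : ℝ} {s u w : E}
    (hu : u ∈ proxSet γ h s) {a b : ℝ} (ha : h u = (a : EReal)) (hb : h w = (b : EReal)) :
    a + 1 / (2 * γ) * ‖u - s‖ ^ 2 ≤ b + 1 / (2 * γ) * ‖w - s‖ ^ 2 := by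
  have := hu.2 w
  simp only [ha, hb] at this
  exact_mod_cast this

theorem quadratic_minorant_of_mem_proxSet {h : E → EReal} (hbot : ∀ x, h x ≠ ⊥) {γ : ℝ} {s u : E}
    (hγ : 0 < γ) (hu : u ∈ proxSet γ h s) {a : ℝ} (ha : h u = (a : EReal)) (y : E) :
    ((a + inner ℝ ((1 / γ) • (s - u)) (y - u) - 1 / (2 * γ) * ‖y - u‖ ^ 2 : ℝ) : EReal) ≤ h y := by
  refine EReal.coe_le_of_forall_coe (hbot y) fun b hb => ?_
  have h1 := le_of_mem_proxSet hu ha hb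
  have h2 : ‖y - s‖ ^ 2 = ‖y - u‖ ^ 2 - 2 * inner ℝ (s - u) (y - u) + ‖u - s‖ ^ 2 := by
    rw [show y - s = (y - u) - (s - u) by abel, norm_sub_sq_real, norm_sub_rev s u,
      real_inner_comm]
  rw [h2] at h1
  rw [real_inner_smul_left]
  have h3 : 1 / (2 * γ) * (2 * inner ℝ (s - u) (y - u)) = 1 / γ * inner ℝ (s - u) (y - u) := by
    field_simp
  linarith

/-- Existence of proximal points of a function with a quadratic minorant. -/
theorem proxSet_nonempty {E : Type*} [NormedAddCommGroup E] [ProperSpace E] {h : E → EReal} (hlsc : LowerSemicontinuous h)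
    (hprop : IsProper h) {γ a b c : ℝ} (hc : c < 1 / (2 * γ))
    (hmin : ∀ w, ((-a - b * ‖w‖ - c * ‖w‖ ^ 2 : ℝ) : EReal) ≤ h w) (hγ : 0 < γ) (s : E) :
    (proxSet γ h s).Nonempty := by
  obtain ⟨w₀, hw₀⟩ := hprop.2
  obtain ⟨h₀, hh₀⟩ := EReal.exists_coe_of_ne_bot_of_lt_top (hprop.1 w₀) hw₀
  set q : E → ℝ := fun w => 1 / (2 * γ) * ‖w - s‖ ^ 2 with hq
  set A : ℝ := h₀ + q w₀ with hA
  set e : ℝ := 1 / (2 * γ) - c with he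
  have he0 : 0 < e := by rw [he]; linarith
  set B : ℝ := |b| + ‖s‖ / γ with hB
  -- With this radius, `‖w‖ > R` gives `‖w‖ ≥ 1` and `e‖w‖ - B ≥ |A + a|`, so the objective is at
  -- least its value `A` at `w₀`. A minimizer over a ball that also contains `w₀` is then global.
  set R : ℝ := 1 + (B + |A + a|) / e with hR
  have hB0 : 0 ≤ B := by positivity
  have hout : ∀ w, R < ‖w‖ → ((A : ℝ) : EReal) ≤ h w + (q w : EReal) := by
    intro w hw
    have hqw : (‖w‖ - ‖s‖) ^ 2 ≤ ‖w - s‖ ^ 2 :=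
      sq_le_sq.2 ((abs_norm_sub_norm_le w s).trans (le_abs_self _))
    have h1 : e * ‖w‖ ≥ e + B + |A + a| := by
      have : e * R ≤ e * ‖w‖ := by gcongr
      rw [hR, mul_add, mul_div_cancel₀ _ he0.ne'] at this
      linarith
    have hR1 : 1 ≤ ‖w‖ := by
      have : (0 : ℝ) ≤ (B + |A + a|) / e := by positivity
      linarith
    have h2 : A + a ≤ ‖w‖ * (e * ‖w‖ - B) := by
      have := le_abs_self (A + a)
      have := abs_nonneg (A + a)
      nlinarith
    have h3 : 1 / (2 * γ) * ((‖w‖ - ‖s‖) ^ 2) ≤ q w :=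
      mul_le_mul_of_nonneg_left hqw (by positivity)
    have h4 : 1 / (2 * γ) * ((‖w‖ - ‖s‖) ^ 2) =
        1 / (2 * γ) * ‖w‖ ^ 2 - ‖s‖ / γ * ‖w‖ + 1 / (2 * γ) * ‖s‖ ^ 2 := by
      field_simp
      ring
    have h5 : 0 ≤ 1 / (2 * γ) * ‖s‖ ^ 2 := by positivity
    have h6 : b * ‖w‖ ≤ |b| * ‖w‖ := by gcongr; exact le_abs_self b
    have h7 : A ≤ (-a - b * ‖w‖ - c * ‖w‖ ^ 2) + q w := by
      rw [he, hB] at h2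
      nlinarith
    calc ((A : ℝ) : EReal) ≤ ((-a - b * ‖w‖ - c * ‖w‖ ^ 2 : ℝ) : EReal) + (q w : EReal) := by
          exact_mod_cast h7
      _ ≤ _ := add_le_add_left (hmin w) _
  have hg : LowerSemicontinuous fun w => h w + (q w : EReal) :=
    lowerSemicontinuous_add_of_ne_bot hlsc (lowerSemicontinuous_coe (by fun_prop)) hprop.1
      fun x => EReal.coe_ne_bot _
  obtain ⟨x, -, hx⟩ := (hg.lowerSemicontinuousOn _).exists_isMinOn
    (s := Metric.closedBall (0 : E) (max R ‖w₀‖)) ⟨w₀, by simp⟩ (isCompact_closedBall _ _)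
  have hxA : h x + (q x : EReal) ≤ (A : EReal) := by
    have := isMinOn_iff.1 hx w₀ (by simp)
    rw [hh₀] at this
    exact_mod_cast this
  refine ⟨x, hxA.trans_lt (EReal.coe_lt_top A), fun y => ?_⟩
  by_cases hy : ‖y‖ ≤ max R ‖w₀‖
  · exact isMinOn_iff.1 hx y (by simpa using hy)
  · exact hxA.trans (hout y ((le_max_left _ _).trans_lt (not_le.1 hy)))

/-! ### Convex and strongly convex functions -/

theorem ExtConvex.extStronglyConvex_zero {h : E → EReal} (hh : ExtConvex h) :
    ExtStronglyConvex 0 h := by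
  simpa [ExtStronglyConvex] using hh

theorem ExtStronglyConvex.le {h : E → EReal} {μ : ℝ} (hh : ExtStronglyConvex μ h)
    {x y : E} {a b : ℝ} (hx : h x = (a : EReal)) (hy : h y = (b : EReal))
    {t : ℝ} (ht0 : 0 ≤ t) (ht1 : t ≤ 1) :
    h (x + t • (y - x)) ≤
      (((1 - t) * a + t * b - μ / 2 * (t * (1 - t)) * ‖y - x‖ ^ 2 : ℝ) : EReal) := by
  have h1 := hh x y (1 - t) t (by linarith) ht0 (by ring)
  have hz : (1 - t) • x + t • y = x + t • (y - x) := by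
    rw [sub_smul, smul_sub, one_smul]; abel
  have hn : ‖x + t • (y - x)‖ ^ 2 =
      (1 - t) * ‖x‖ ^ 2 + t * ‖y‖ ^ 2 - t * (1 - t) * ‖y - x‖ ^ 2 := by
    simp only [← real_inner_self_eq_norm_sq, inner_add_left, inner_add_right, inner_sub_left,
      inner_sub_right, real_inner_smul_right, real_inner_comm]
    ring
  simp only [hx, hy, hz] at h1
  generalize h (x + t • (y - x)) = hv at h1
  induction hv with
  | bot => exact bot_le
  | coe c =>
    have h2 : c - μ / 2 * ‖x + t • (y - x)‖ ^ 2 ≤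
        (1 - t) * (a - μ / 2 * ‖x‖ ^ 2) + t * (b - μ / 2 * ‖y‖ ^ 2) := by exact_mod_cast h1
    rw [hn] at h2
    have : c ≤ (1 - t) * a + t * b - μ / 2 * (t * (1 - t)) * ‖y - x‖ ^ 2 := by linarith
    exact_mod_cast this
  | top =>
    rw [EReal.top_sub_coe] at h1
    exact absurd (top_le_iff.1 h1) (by exact_mod_cast EReal.coe_ne_top _)

/-- Proximal points yield strong subgradients. -/
theorem ExtStronglyConvex.subgradient_of_mem_proxSet {h : E → EReal} {μ : ℝ}
    (hh : ExtStronglyConvex μ h) {γ : ℝ} {s u : E}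
    (hu : u ∈ proxSet γ h s) {x : E} {a b : ℝ} (ha : h u = (a : EReal)) (hb : h x = (b : EReal)) :
    a + 1 / γ * inner ℝ (s - u) (x - u) + μ / 2 * ‖x - u‖ ^ 2 ≤ b := by
  set N := ‖x - u‖ ^ 2 with hN
  set I := (inner ℝ (s - u) (x - u) : ℝ) with hI
  -- Minimality of `u` is tested at `u + t (x - u)`, the result is divided by `t`, and then `t`
  -- tends to `0`.
  have key : ∀ t : ℝ, 0 < t → t ≤ 1 →
      a + 1 / γ * I + μ / 2 * N ≤ b + t * ((μ / 2 + 1 / (2 * γ)) * N) := by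
    intro t ht0 ht1
    have h1 := hh.le ha hb ht0.le ht1
    have h2 := hu.2 (u + t • (x - u))
    have hn : ‖u + t • (x - u) - s‖ ^ 2 = ‖u - s‖ ^ 2 - 2 * t * I + t ^ 2 * N := by
      rw [hN, hI]
      simp only [← real_inner_self_eq_norm_sq, inner_add_left, inner_add_right, inner_sub_left,
        inner_sub_right, real_inner_smul_right, real_inner_comm]
      ring
    have h3 := h2.trans (add_le_add_left h1 _)
    simp only [ha, hn] at h3
    have h4 : a + 1 / (2 * γ) * ‖u - s‖ ^ 2 ≤
        (1 - t) * a + t * b - μ / 2 * (t * (1 - t)) * N +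
          1 / (2 * γ) * (‖u - s‖ ^ 2 - 2 * t * I + t ^ 2 * N) := by exact_mod_cast h3
    have h5 : 1 / γ = 2 * (1 / (2 * γ)) := by
      -- No sign of `γ` is assumed; at `γ = 0` both sides are `0` by the convention for division.
      rcases eq_or_ne γ 0 with rfl | h0
      · simp
      · field_simp
    rw [h5]
    refine le_of_mul_le_mul_left ?_ ht0
    linarith
  have hlim : Tendsto (fun t : ℝ => b + t * ((μ / 2 + 1 / (2 * γ)) * N)) (𝓝[>] 0) (𝓝 b) := by
    have : Continuous fun t : ℝ => b + t * ((μ / 2 + 1 / (2 * γ)) * N) := by fun_prop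
    simpa using (this.tendsto 0).mono_left nhdsWithin_le_nhds
  refine ge_of_tendsto hlim ?_
  filter_upwards [Ioc_mem_nhdsGT (zero_lt_one' ℝ)] with t ht
  exact key t ht.1 ht.2

/-- A proper lower semicontinuous convex function decreases at most linearly. -/
theorem ExtConvex.exists_linear_minorant [ProperSpace E] {h : E → EReal} (hh : ExtConvex h)
    (hlsc : LowerSemicontinuous h) (hprop : IsProper h) :
    ∃ a b : ℝ, ∀ w, ((-a - b * ‖w‖ : ℝ) : EReal) ≤ h w := by
  obtain ⟨x, hx⟩ := hprop.2
  obtain ⟨c, hc⟩ := EReal.exists_coe_of_ne_bot_of_lt_top (hprop.1 x) hx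
  obtain ⟨z, -, hz⟩ := (hlsc.lowerSemicontinuousOn _).exists_isMinOn
    (s := Metric.closedBall x 1) ⟨x, by simp⟩ (isCompact_closedBall _ _)
  have hzx : h z ≤ h x := isMinOn_iff.1 hz x (by simp)
  obtain ⟨m, hm⟩ := EReal.exists_coe_of_ne_bot_of_lt_top (hprop.1 z) (hzx.trans_lt hx)
  have hmc : m ≤ c := by
    rw [hm, hc] at hzx
    exact_mod_cast hzx
  -- With `m` the minimum of `h` over the unit ball around `x` and `c = h x`, the claim is `h w ≥ m
  -- - (c - m)‖w - x‖`. Outside the ball it follows from convexity on the segment from `x` to `w`,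
  -- at the point at distance `1` from `x`, where `h ≥ m`.
  refine ⟨-(m - (c - m) * ‖x‖), c - m, fun w => ?_⟩
  refine EReal.coe_le_of_forall_coe (hprop.1 w) fun d hd => ?_
  have hwx : ‖w - x‖ ≤ ‖w‖ + ‖x‖ := norm_sub_le w x
  suffices m - (c - m) * ‖w - x‖ ≤ d by nlinarith
  rcases le_or_gt ‖w - x‖ 1 with hle | hgt
  · have h1 := isMinOn_iff.1 hz w (by simpa [dist_eq_norm] using hle)
    rw [hm, hd] at h1
    have h2 : m ≤ d := by exact_mod_cast h1
    nlinarith [norm_nonneg (w - x)]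
  · have hpos : 0 < ‖w - x‖ := by linarith
    have h1 := hh.extStronglyConvex_zero.le hc hd (t := ‖w - x‖⁻¹) (by positivity)
      (inv_le_one_of_one_le₀ hgt.le)
    have h2 := isMinOn_iff.1 hz (x + ‖w - x‖⁻¹ • (w - x)) (by
      simp [norm_smul, hpos.ne'])
    have h3 := h2.trans h1
    rw [hm] at h3
    have h4 : m ≤ (1 - ‖w - x‖⁻¹) * c + ‖w - x‖⁻¹ * d := by
      have : m ≤ (1 - ‖w - x‖⁻¹) * c + ‖w - x‖⁻¹ * d -
          0 / 2 * (‖w - x‖⁻¹ * (1 - ‖w - x‖⁻¹)) * ‖w - x‖ ^ 2 := by exact_mod_cast h3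
      simpa using this
    have h5 : ‖w - x‖ * m ≤ ‖w - x‖ * ((1 - ‖w - x‖⁻¹) * c + ‖w - x‖⁻¹ * d) := by gcongr
    have h6 : ‖w - x‖ * ((1 - ‖w - x‖⁻¹) * c + ‖w - x‖⁻¹ * d) = (‖w - x‖ - 1) * c + d := by
      field_simp
    nlinarith

theorem upperSemicontinuous_of_le_add_norm {E : Type*} [SeminormedAddCommGroup E] {ψ : E → ℝ}
    (h : ∀ s, ∃ A B : ℝ, ∀ s', ψ s' ≤ ψ s + A * ‖s' - s‖ + B * ‖s' - s‖ ^ 2) :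
    UpperSemicontinuous ψ := by
  intro s y hy
  obtain ⟨A, B, hAB⟩ := h s
  have hcont : Continuous fun s' => ψ s + A * ‖s' - s‖ + B * ‖s' - s‖ ^ 2 := by fun_prop
  have hlim : Tendsto (fun s' => ψ s + A * ‖s' - s‖ + B * ‖s' - s‖ ^ 2) (𝓝 s) (𝓝 (ψ s)) := by
    simpa using hcont.tendsto s
  filter_upwards [hlim.eventually (gt_mem_nhds hy)] with s' hs'
  exact (hAB s').trans_lt hs'

end ExtendedReal

/-! ### The quadratic estimate behind the decrease constant -/

section DecreaseConst

variable {E : Type*} [SeminormedAddCommGroup E]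

open Classical in
-- The bound `‖a + b‖ ≤ (1 + α)‖a‖` accounts for the factor `(1 + α)⁻²` in the constant, and `hD`
-- leaves `(2 - λ)/2 - ακ` as the coefficient of `‖a‖²/λ`. It is used with `(a, b) = (δ, G)` in the
-- smooth setting and `(G, δ)` in the strongly convex one.
theorem decreaseConst_mul_norm_sq_le (cvx : Prop) {α lam D : ℝ} {a b : E} (hα : 0 ≤ α)
    (hlam : 0 < lam) (hC : 0 ≤ decreaseConst cvx α lam) (hab : ‖b‖ ≤ α * ‖a‖)
    (hD : ‖b‖ ^ 2 ≤ lam * D + α * (if cvx then max (α - lam / 2) 0 else 1) * ‖a‖ ^ 2) :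
    decreaseConst cvx α lam * (‖a + b‖ ^ 2 / lam ^ 2) ≤
      D + (1 / lam) * (‖a‖ ^ 2 - ‖b‖ ^ 2) - 1 / 2 * ‖a‖ ^ 2 := by
  have h1 : ‖a + b‖ ≤ (1 + α) * ‖a‖ := by
    have := norm_add_le a b
    linarith
  have h2 : decreaseConst cvx α lam * (‖a + b‖ ^ 2 / lam ^ 2) ≤
      decreaseConst cvx α lam * (((1 + α) * ‖a‖) ^ 2 / lam ^ 2) := by gcongr
  refine h2.trans ?_
  rw [decreaseConst]
  generalize (if cvx then max (α - lam / 2) 0 else 1) = κ at hD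
  have h3 : lam / (1 + α) ^ 2 * ((2 - lam) / 2 - α * κ) * (((1 + α) * ‖a‖) ^ 2 / lam ^ 2) =
      (1 / lam) * (((2 - lam) / 2 - α * κ) * ‖a‖ ^ 2) := by
    field_simp
  have h4 : D + (1 / lam) * (‖a‖ ^ 2 - ‖b‖ ^ 2) - 1 / 2 * ‖a‖ ^ 2 =
      (1 / lam) * (lam * D + (‖a‖ ^ 2 - ‖b‖ ^ 2) - lam / 2 * ‖a‖ ^ 2) := by
    field_simp
  rw [h3, h4]
  gcongr
  linarith

open Classical in
-- If `α ≤ λ/2`, cocoercivity alone suffices. Otherwise a share `λ/(2α)` of `‖b‖²` is bounded by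
-- cocoercivity and the rest by the Lipschitz bound, which produces `κ = α - λ/2`.
theorem norm_sq_le_of_cocoercive {cvx : Prop} (hcvx : cvx) {α lam D : ℝ} {a b : E}
    (hlam : 0 < lam) (hD0 : 0 ≤ D) (hab : ‖b‖ ≤ α * ‖a‖) (hD : ‖b‖ ^ 2 ≤ 2 * α * D) :
    ‖b‖ ^ 2 ≤ lam * D + α * (if cvx then max (α - lam / 2) 0 else 1) * ‖a‖ ^ 2 := by
  rw [if_pos hcvx]
  rcases le_or_gt α (lam / 2) with h | h
  · rw [max_eq_right (by linarith)]
    nlinarith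
  · rw [max_eq_left (by linarith)]
    have hα' : 0 < α := by linarith
    have h1 : ‖b‖ ^ 2 ≤ (α * ‖a‖) ^ 2 := by gcongr
    refine le_of_mul_le_mul_left ?_ hα'
    nlinarith

open Classical in
-- Here `D` may be negative, at a cost of `λα/2 ‖a‖²`; the stepsize bound is exactly `α + λ/2 ≤ 1`,
-- whence `κ = 1`.
theorem norm_sq_le_of_weakly_convex {cvx : Prop} (hcvx : ¬ cvx) {α lam D : ℝ} {a b : E}
    (hα : 0 ≤ α) (hlam : 0 < lam) (hα' : α ≤ (2 - lam) / 2) (hab : ‖b‖ ≤ α * ‖a‖)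
    (hD : -(α / 2 * ‖a‖ ^ 2) ≤ D) :
    ‖b‖ ^ 2 ≤ lam * D + α * (if cvx then max (α - lam / 2) 0 else 1) * ‖a‖ ^ 2 := by
  rw [if_neg hcvx]
  have h1 : ‖b‖ ^ 2 ≤ (α * ‖a‖) ^ 2 := by gcongr
  have h2 : α * (α + lam / 2) * ‖a‖ ^ 2 ≤ α * 1 * ‖a‖ ^ 2 := by gcongr; linarith
  nlinarith

end DecreaseConst

/-! ### Real-valued envelope estimates -/

section Envelope

variable {E : Type*} [NormedAddCommGroup E] [InnerProductSpace ℝ E]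

/-- The Douglas-Rachford envelope, with the values `a = φ₁ u` and `b = φ₂ v`. -/
noncomputable def dreReal (γ a b : ℝ) (s u v : E) : ℝ :=
  a + b + (1 / γ * inner ℝ (s - u) (v - u) + 1 / (2 * γ) * ‖v - u‖ ^ 2)

theorem dreValue_eq_dreReal {φ₁ φ₂ : E → EReal} {γ a b : ℝ} {s u v : E} (ha : φ₁ u = (a : EReal))
    (hb : φ₂ v = (b : EReal)) : dreValue γ φ₁ φ₂ s u v = (dreReal γ a b s u v : EReal) := by
  rw [dreValue, ha, hb, dreReal]
  exact_mod_cast rfl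

theorem mul_dreReal {γ : ℝ} (hγ : 0 < γ) (a b : ℝ) (s u v : E) :
    γ * dreReal γ a b s u v =
      γ * a + γ * b + inner ℝ (s - u) (v - u) + 1 / 2 * ‖v - u‖ ^ 2 := by
  rw [dreReal]
  field_simp
  ring

/-- Up to terms free of `v`, the envelope is the objective of the second proximal problem, so
replacing `v'` by `v` can only increase it. -/
theorem mul_dreReal_sub_le {γ : ℝ} (hγ : 0 < γ) {a b a' b' : ℝ} {s u v s' u' v' : E}
    (h : b' + 1 / (2 * γ) * ‖v' - ((2 : ℝ) • u' - s')‖ ^ 2 ≤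
      b + 1 / (2 * γ) * ‖v - ((2 : ℝ) • u' - s')‖ ^ 2) :
    γ * (dreReal γ a' b' s' u' v' - dreReal γ a b s u v) ≤
      -(γ * (a - a') - inner ℝ (s' - u') (u - u')) +
        inner ℝ (u - v) ((u' - u) - ((s' - u') - (s - u))) + 1 / 2 * ‖u' - u‖ ^ 2 := by
  have h1 : γ * b' + 1 / 2 * ‖v' - ((2 : ℝ) • u' - s')‖ ^ 2 ≤
      γ * b + 1 / 2 * ‖v - ((2 : ℝ) • u' - s')‖ ^ 2 := by
    have := mul_le_mul_of_nonneg_left h hγ.le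
    have e : ∀ x : ℝ, γ * (1 / (2 * γ) * x) = 1 / 2 * x := fun x => by field_simp
    rwa [mul_add, mul_add, e, e] at this
  rw [mul_sub, mul_dreReal hγ, mul_dreReal hγ]
  simp only [← real_inner_self_eq_norm_sq, inner_sub_left, inner_sub_right, real_inner_smul_right,
    real_inner_comm] at h1 ⊢
  linarith

theorem le_mul_dreReal_sub {γ : ℝ} (hγ : 0 < γ) {a b a' b' : ℝ} {s u v s' u' v' : E}
    (h : b + 1 / γ * inner ℝ ((2 : ℝ) • u - s - v) (v' - v) ≤ b') :
    (γ * (a' - a) - inner ℝ (s - u) (u' - u)) +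
        inner ℝ (u - v) ((u' - u) - ((s' - u') - (s - u))) -
        1 / 2 * ‖(s' - u') - (s - u)‖ ^ 2 ≤
      γ * (dreReal γ a' b' s' u' v' - dreReal γ a b s u v) := by
  have h1 : γ * b + inner ℝ ((2 : ℝ) • u - s - v) (v' - v) ≤ γ * b' := by
    have := mul_le_mul_of_nonneg_left h hγ.le
    have e : ∀ x : ℝ, γ * (1 / γ * x) = x := fun x => by field_simp
    rwa [mul_add, e] at this
  -- This square completes the expression in the change of the residual; discarding it removes `v'`
  -- from the bound.
  have h2 : 0 ≤ ‖(s' - u') - (s - u) - ((u' - v') - (u - v))‖ ^ 2 := by positivity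
  rw [mul_sub γ (dreReal _ _ _ _ _ _), mul_dreReal hγ, mul_dreReal hγ]
  simp only [← real_inner_self_eq_norm_sq, inner_sub_left, inner_sub_right, real_inner_smul_right,
    real_inner_comm] at h1 h2 ⊢
  linarith

theorem inner_sub_of_add_eq_neg_smul {lam : ℝ} (hlam : 0 < lam) {r x y : E}
    (h : x + y = -(lam • r)) :
    inner ℝ r (x - y) = -(1 / lam * (‖x‖ ^ 2 - ‖y‖ ^ 2)) ∧ ‖x + y‖ ^ 2 / lam ^ 2 = ‖r‖ ^ 2 := by
  constructor
  · have h1 : inner ℝ (x + y) (x - y) = ‖x‖ ^ 2 - ‖y‖ ^ 2 := by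
      simp only [← real_inner_self_eq_norm_sq, inner_add_left, inner_sub_right, real_inner_comm]
      ring
    rw [h, inner_neg_left, real_inner_smul_left] at h1
    field_simp
    linarith
  · rw [h, norm_neg, norm_smul, Real.norm_of_nonneg hlam.le]
    field_simp

theorem abs_inner_sub_le_of_norm_le {r x y : E} {A : ℝ} (hx : ‖x‖ ≤ A) (hy : ‖y‖ ≤ A) :
    |inner ℝ r (x - y)| ≤ ‖r‖ * (2 * A) := by
  refine (abs_real_inner_le_norm r _).trans ?_
  gcongr
  linarith [norm_sub_le x y]

end Envelope

/-! ### Functions with Lipschitz gradient -/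

section LipschitzGradient

variable {E : Type*} [NormedAddCommGroup E] [InnerProductSpace ℝ E] [CompleteSpace E]

theorem hasDerivAt_comp_line {f : E → ℝ} (hf : Differentiable ℝ f) (x d : E) (t : ℝ) :
    HasDerivAt (fun t : ℝ => f (x + t • d)) (inner ℝ (gradient f (x + t • d)) d) t := by
  have h1 : HasDerivAt (fun t : ℝ => x + t • d) d t := by
    simpa using ((hasDerivAt_id t).smul_const d).const_add x
  have h2 := (hf (x + t • d)).hasGradientAt.hasFDerivAt.comp_hasDerivAt t h1
  simp only [InnerProductSpace.toDual_apply_apply] at h2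
  exact h2

/-- The descent lemma. -/
theorem le_add_inner_gradient_add_sq {f : E → ℝ} {L : ℝ≥0} (hf : Differentiable ℝ f)
    (hL : LipschitzWith L (gradient f)) (x y : E) :
    f y ≤ f x + inner ℝ (gradient f x) (y - x) + L / 2 * ‖y - x‖ ^ 2 := by
  set d := y - x with hd
  -- Lipschitz continuity of the gradient makes `g` antitone on `[0, 1]`; the claim is `g 1 ≤ g 0`.
  set g : ℝ → ℝ := fun t =>
    f (x + t • d) - t * inner ℝ (gradient f x) d - L / 2 * t ^ 2 * ‖d‖ ^ 2 with hg
  have hderiv : ∀ t, HasDerivAt g (inner ℝ (gradient f (x + t • d)) d -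
      inner ℝ (gradient f x) d - L * t * ‖d‖ ^ 2) t := by
    intro t
    have h1 := ((hasDerivAt_comp_line hf x d t).sub
      ((hasDerivAt_id t).mul_const (inner ℝ (gradient f x) d))).sub
      (((hasDerivAt_pow 2 t).const_mul ((L : ℝ) / 2)).mul_const (‖d‖ ^ 2))
    refine h1.congr_deriv ?_
    simp only [one_mul, Nat.cast_ofNat, Nat.add_one_sub_one, pow_one]
    ring
  have hanti : AntitoneOn g (Icc 0 1) := by
    refine antitoneOn_of_deriv_nonpos (convex_Icc 0 1)
      (fun t _ => (hderiv t).continuousAt.continuousWithinAt)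
      (fun t _ => (hderiv t).differentiableAt.differentiableWithinAt) fun t ht => ?_
    rw [interior_Icc] at ht
    rw [(hderiv t).deriv, ← inner_sub_left]
    have h2 : ‖gradient f (x + t • d) - gradient f x‖ ≤ L * (t * ‖d‖) := by
      have := hL.norm_sub_le (x + t • d) x
      rwa [add_sub_cancel_left, norm_smul, Real.norm_of_nonneg ht.1.le] at this
    have h3 := real_inner_le_norm (gradient f (x + t • d) - gradient f x) d
    have h4 : ‖gradient f (x + t • d) - gradient f x‖ * ‖d‖ ≤ L * (t * ‖d‖) * ‖d‖ := by gcongr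
    linarith
  have h := hanti (left_mem_Icc.2 zero_le_one) (right_mem_Icc.2 zero_le_one) zero_le_one
  simp only [hg, one_smul, zero_smul, add_zero, hd, add_sub_cancel] at h
  linarith

theorem add_inner_gradient_sub_sq_le {f : E → ℝ} {L : ℝ≥0} (hf : Differentiable ℝ f)
    (hL : LipschitzWith L (gradient f)) (x y : E) :
    f x + inner ℝ (gradient f x) (y - x) - L / 2 * ‖y - x‖ ^ 2 ≤ f y := by
  have hgrad : gradient (fun z => -f z) = fun z => -gradient f z := by
    funext z
    have : HasGradientAt (fun z => -f z) (-gradient f z) z := by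
      rw [hasGradientAt_iff_hasFDerivAt, map_neg]
      exact (hf z).hasGradientAt.hasFDerivAt.neg
    exact this.gradient
  have h := le_add_inner_gradient_add_sq (f := fun z => -f z) (L := L) hf.neg (by
    rw [hgrad]
    exact hL.neg) x y
  rw [hgrad, inner_neg_left] at h
  linarith

/-- Cocoercivity of the gradient at a point where the gradient is a subgradient. -/
theorem norm_gradient_sub_sq_le {f : E → ℝ} {L : ℝ≥0} (hf : Differentiable ℝ f)
    (hL : LipschitzWith L (gradient f)) {x : E}
    (hx : ∀ w, f x + inner ℝ (gradient f x) (w - x) ≤ f w) (y : E) :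
    ‖gradient f y - gradient f x‖ ^ 2 ≤
      2 * L * (f y - f x - inner ℝ (gradient f x) (y - x)) := by
  set g := gradient f y - gradient f x with hg
  rcases eq_or_lt_of_le L.2 with h0 | h0
  · have h1 := hL.norm_sub_le y x
    have h2 : (L : ℝ) = 0 := h0.symm
    rw [h2, zero_mul, ← hg] at h1
    have h3 : ‖g‖ = 0 := le_antisymm h1 (norm_nonneg _)
    simp [h2, h3]
  · have hL0 : (0 : ℝ) < L := h0
    -- The subgradient inequality at `x` and the descent lemma at `y` are compared at a gradient
    -- step from `y` on `f - ⟪∇f x, ·⟫`. The case `L = 0` is separate because of the step length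
    -- `1/L`.
    have h1 := hx (y - (1 / (L : ℝ)) • g)
    have h2 := le_add_inner_gradient_add_sq hf hL y (y - (1 / (L : ℝ)) • g)
    have h3 : inner ℝ (gradient f y) g - inner ℝ (gradient f x) g = ‖g‖ ^ 2 := by
      rw [← inner_sub_left, ← hg, real_inner_self_eq_norm_sq]
    have h4 : y - (1 / (L : ℝ)) • g - y = -((1 / (L : ℝ)) • g) := by abel
    have h5 : y - (1 / (L : ℝ)) • g - x = (y - x) - (1 / (L : ℝ)) • g := by abel
    rw [h4, inner_neg_right, norm_neg, norm_smul, Real.norm_of_nonneg (by positivity),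
      real_inner_smul_right] at h2
    rw [h5, inner_sub_right, real_inner_smul_right] at h1
    have h6 : 1 / (L : ℝ) * inner ℝ (gradient f y) g - 1 / (L : ℝ) * inner ℝ (gradient f x) g =
        1 / (L : ℝ) * ‖g‖ ^ 2 := by rw [← mul_sub, h3]
    have h7 : (L : ℝ) / 2 * (1 / L * ‖g‖) ^ 2 = 1 / 2 * (1 / (L : ℝ) * ‖g‖ ^ 2) := by
      field_simp
    have h8 : 1 / (L : ℝ) * ‖g‖ ^ 2 ≤ 2 * (f y - f x - inner ℝ (gradient f x) (y - x)) := by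
      linarith
    rw [one_div, inv_mul_le_iff₀ hL0] at h8
    linarith

theorem smul_gradient_eq_of_mem_proxSet {φ : E → EReal} {f : E → ℝ} (hφ : ∀ x, φ x = (f x : EReal))
    (hf : Differentiable ℝ f) {γ : ℝ} (hγ : 0 < γ) {s u : E} (hu : u ∈ proxSet γ φ s) :
    γ • gradient f u = s - u := by
  have hmin : ∀ y, f u + inner ℝ ((1 / γ) • (s - u)) (y - u) - 1 / (2 * γ) * ‖y - u‖ ^ 2 ≤ f y := by
    intro y
    have := quadratic_minorant_of_mem_proxSet (fun x => by simp [hφ]) hγ hu (hφ u) y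
    rw [hφ] at this
    exact_mod_cast this
  have h0 : gradient f u = (1 / γ) • (s - u) := by
    refine ext_inner_right ℝ fun d => ?_
    set g : ℝ → ℝ := fun t => f (u + t • d) - t * inner ℝ ((1 / γ) • (s - u)) d +
      1 / (2 * γ) * t ^ 2 * ‖d‖ ^ 2 with hg
    have hderiv : HasDerivAt g (inner ℝ (gradient f u) d - inner ℝ ((1 / γ) • (s - u)) d) 0 := by
      have h1 := ((hasDerivAt_comp_line hf u d 0).sub
        ((hasDerivAt_id (0 : ℝ)).mul_const (inner ℝ ((1 / γ) • (s - u)) d))).add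
        (((hasDerivAt_pow 2 (0 : ℝ)).const_mul (1 / (2 * γ))).mul_const (‖d‖ ^ 2))
      refine h1.congr_deriv ?_
      simp
    have hloc : IsLocalMin g 0 := by
      refine Filter.Eventually.of_forall fun t => ?_
      have h1 := hmin (u + t • d)
      rw [add_sub_cancel_left, inner_smul_right, norm_smul, mul_pow, Real.norm_eq_abs, sq_abs] at h1
      simp only [hg]
      simp only [zero_smul, add_zero]
      linarith
    have := hloc.hasDerivAt_eq_zero hderiv
    linarith
  rw [h0, smul_smul, mul_one_div_cancel hγ.ne', one_smul]

end LipschitzGradient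

/-! ### Merit functions from estimates for pairs of updates -/

/-- The one-sided estimate `hcont` does double duty: it gives upper semicontinuity, and at `s' = s`,
used in both directions, independence of the oracle result. -/
theorem exists_meritFunction {E : Type*} [NormedAddCommGroup E] [InnerProductSpace ℝ E]
    {P : LSParams} {φ₁ φ₂ : E → EReal} (hb₁ : ∀ x, φ₁ x ≠ ⊥) (hb₂ : ∀ x, φ₂ x ≠ ⊥)
    (hπ : P.π ≠ 0) (hne : ∀ s, (drsOracle P.γ φ₁ φ₂ s).Nonempty) {C m : ℝ} (hC : P.c < C)
    (hcont : ∀ s u v, (u, v) ∈ drsOracle P.γ φ₁ φ₂ s → ∀ a b : ℝ, φ₁ u = a → φ₂ v = b →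
      ∃ A B : ℝ, ∀ s' u' v', (u', v') ∈ drsOracle P.γ φ₁ φ₂ s' →
        ∀ a' b' : ℝ, φ₁ u' = a' → φ₂ v' = b' →
        P.π * dreReal P.γ a' b' s' u' v' ≤
          P.π * dreReal P.γ a b s u v + A * ‖s' - s‖ + B * ‖s' - s‖ ^ 2)
    (hdec : ∀ s u v, (u, v) ∈ drsOracle P.γ φ₁ φ₂ s → ∀ a b : ℝ, φ₁ u = a → φ₂ v = b →
      ∀ u' v', (u', v') ∈ drsOracle P.γ φ₁ φ₂ (nominalStep P.lam s u v) →
        ∀ a' b' : ℝ, φ₁ u' = a' → φ₂ v' = b' →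
        P.π * dreReal P.γ a' b' (nominalStep P.lam s u v) u' v' ≤
          P.π * dreReal P.γ a b s u v - C / P.γ * ‖u - v‖ ^ 2)
    (hlow : ∀ s u v, (u, v) ∈ drsOracle P.γ φ₁ φ₂ s → ∀ a b : ℝ, φ₁ u = a → φ₂ v = b →
      P.π * m ≤ P.π * dreReal P.γ a b s u v) :
    ∃ dre : E → ℝ, (∀ s u v, (u, v) ∈ drsOracle P.γ φ₁ φ₂ s →
        dreValue P.γ φ₁ φ₂ s u v = (dre s : EReal)) ∧
      MeritFunction P φ₁ φ₂ (fun s => P.π * dre s) (P.π * m) := by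
  have hreal : ∀ {s u v}, (u, v) ∈ drsOracle P.γ φ₁ φ₂ s →
      ∃ a b : ℝ, φ₁ u = a ∧ φ₂ v = b := fun h => by
    obtain ⟨a, ha⟩ := exists_coe_of_mem_proxSet hb₁ h.1
    obtain ⟨b, hb⟩ := exists_coe_of_mem_proxSet hb₂ h.2
    exact ⟨a, b, ha, hb⟩
  choose q hq using hne
  choose a b ha hb using fun s => hreal (hq s)
  have hval : ∀ s u v, (u, v) ∈ drsOracle P.γ φ₁ φ₂ s → ∀ a' b' : ℝ, φ₁ u = a' → φ₂ v = b' →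
      dreReal P.γ a' b' s u v = dreReal P.γ (a s) (b s) s (q s).1 (q s).2 := by
    intro s u v h a' b' ha' hb'
    obtain ⟨A, B, hAB⟩ := hcont _ _ _ h _ _ ha' hb'
    obtain ⟨A', B', hAB'⟩ := hcont _ _ _ (hq s) _ _ (ha s) (hb s)
    have h1 := hAB _ _ _ (hq s) _ _ (ha s) (hb s)
    have h2 := hAB' _ _ _ h _ _ ha' hb'
    simp only [sub_self, norm_zero, mul_zero, add_zero, ne_eq, OfNat.ofNat_ne_zero,
      not_false_eq_true, zero_pow] at h1 h2
    exact mul_left_cancel₀ hπ (le_antisymm h2 h1)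
  have hvalE : ∀ s u v, (u, v) ∈ drsOracle P.γ φ₁ φ₂ s → dreValue P.γ φ₁ φ₂ s u v =
      (dreReal P.γ (a s) (b s) s (q s).1 (q s).2 : EReal) := by
    intro s u v h
    obtain ⟨a', b', ha', hb'⟩ := hreal h
    rw [dreValue_eq_dreReal ha' hb', hval s u v h a' b' ha' hb']
  refine ⟨fun s => dreReal P.γ (a s) (b s) s (q s).1 (q s).2, hvalE, ?_⟩
  refine ⟨fun s => ⟨q s, hq s⟩, fun s u v h => ?_, fun s u v h => ⟨C, hC, ?_⟩,
    upperSemicontinuous_of_le_add_norm fun s => ?_, fun s => hlow _ _ _ (hq s) _ _ (ha s) (hb s)⟩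
  · rw [hvalE s u v h, EReal.coe_mul]
  · obtain ⟨a', b', ha', hb'⟩ := hreal h
    simp only
    rw [← hval s u v h a' b' ha' hb']
    exact hdec _ _ _ h _ _ ha' hb' _ _ (hq _) _ _ (ha _) (hb _)
  · obtain ⟨A, B, hAB⟩ := hcont _ _ _ (hq s) _ _ (ha s) (hb s)
    exact ⟨A, B, fun s' => hAB _ _ _ (hq s') _ _ (ha s') (hb s')⟩

/-! ### The smooth setting -/

section Smooth

variable {E : Type*} [NormedAddCommGroup E] [InnerProductSpace ℝ E]

theorem smooth_mul_dreReal_sub_le {φ₁ φ₂ : E → EReal} {f : E → ℝ} {γ : ℝ}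
    {s u v s' u' v' : E} (hφ : ∀ x, φ₁ x = (f x : EReal)) (hγ : 0 < γ)
    (h' : (u', v') ∈ drsOracle γ φ₁ φ₂ s') {a b a' b' : ℝ}
    (ha : φ₁ u = a) (hb : φ₂ v = b) (ha' : φ₁ u' = a') (hb' : φ₂ v' = b') :
    γ * (dreReal γ a' b' s' u' v' - dreReal γ a b s u v) ≤
      -(γ * (f u - f u') - inner ℝ (s' - u') (u - u')) +
        inner ℝ (u - v) ((u' - u) - ((s' - u') - (s - u))) + 1 / 2 * ‖u' - u‖ ^ 2 := by
  rw [hφ] at ha ha'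
  rw [EReal.coe_eq_coe_iff.1 ha, EReal.coe_eq_coe_iff.1 ha']
  exact mul_dreReal_sub_le hγ (le_of_mem_proxSet h'.2 hb' hb)

section Pair

variable [CompleteSpace E] {φ₁ φ₂ : E → EReal} {f : E → ℝ} {L : ℝ≥0} {γ : ℝ} {s u v s' u' v' : E}

theorem gradient_residual_norm_le (hφ : ∀ x, φ₁ x = (f x : EReal)) (hf : Differentiable ℝ f)
    (hL : LipschitzWith L (gradient f)) (hγ : 0 < γ) (h : u ∈ proxSet γ φ₁ s)
    (h' : u' ∈ proxSet γ φ₁ s') : ‖(s' - u') - (s - u)‖ ≤ γ * L * ‖u' - u‖ := by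
  rw [← smul_gradient_eq_of_mem_proxSet hφ hf hγ h, ← smul_gradient_eq_of_mem_proxSet hφ hf hγ h',
    ← smul_sub, norm_smul, Real.norm_of_nonneg hγ.le, mul_assoc]
  gcongr
  exact hL.norm_sub_le u' u

theorem neg_le_mul_bregman (hφ : ∀ x, φ₁ x = (f x : EReal)) (hf : Differentiable ℝ f)
    (hL : LipschitzWith L (gradient f)) (hγ : 0 < γ) (h' : u' ∈ proxSet γ φ₁ s') :
    -(γ * L / 2 * ‖u' - u‖ ^ 2) ≤ γ * (f u - f u') - inner ℝ (s' - u') (u - u') := by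
  rw [← smul_gradient_eq_of_mem_proxSet hφ hf hγ h', real_inner_smul_left, norm_sub_rev u' u]
  have := mul_le_mul_of_nonneg_left (add_inner_gradient_sub_sq_le hf hL u' u) hγ.le
  linarith

theorem gradient_le_of_extConvex (hφ : ∀ x, φ₁ x = (f x : EReal)) (hf : Differentiable ℝ f)
    (hγ : 0 < γ) (hcvx : ExtConvex φ₁) (h : u ∈ proxSet γ φ₁ s) (w : E) :
    f u + inner ℝ (gradient f u) (w - u) ≤ f w := by
  have := hcvx.extStronglyConvex_zero.subgradient_of_mem_proxSet h (hφ u) (hφ w)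
  rw [← smul_gradient_eq_of_mem_proxSet hφ hf hγ h, real_inner_smul_left] at this
  have e : 1 / γ * (γ * inner ℝ (gradient f u) (w - u)) = inner ℝ (gradient f u) (w - u) := by
    field_simp
  rw [e] at this
  linarith

theorem gradient_residual_cocoercive (hφ : ∀ x, φ₁ x = (f x : EReal)) (hf : Differentiable ℝ f)
    (hL : LipschitzWith L (gradient f)) (hγ : 0 < γ) (hcvx : ExtConvex φ₁)
    (h : u ∈ proxSet γ φ₁ s) (h' : u' ∈ proxSet γ φ₁ s') :
    0 ≤ γ * (f u - f u') - inner ℝ (s' - u') (u - u') ∧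
    ‖(s' - u') - (s - u)‖ ^ 2 ≤
      2 * (γ * L) * (γ * (f u - f u') - inner ℝ (s' - u') (u - u')) := by
  have hsub := gradient_le_of_extConvex hφ hf hγ hcvx h'
  rw [← smul_gradient_eq_of_mem_proxSet hφ hf hγ h, ← smul_gradient_eq_of_mem_proxSet hφ hf hγ h',
    ← smul_sub, norm_smul, Real.norm_of_nonneg hγ.le, mul_pow, norm_sub_rev, real_inner_smul_left,
    ← mul_sub]
  refine ⟨mul_nonneg hγ.le (by linarith [hsub u]), ?_⟩
  have := mul_le_mul_of_nonneg_left (norm_gradient_sub_sq_le hf hL hsub u) (sq_nonneg γ)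
  linarith

theorem smooth_dreReal_le_add (hφ : ∀ x, φ₁ x = (f x : EReal)) (hf : Differentiable ℝ f)
    (hL : LipschitzWith L (gradient f)) (hγ : 0 < γ) (hα : γ * L < 1)
    (h : (u, v) ∈ drsOracle γ φ₁ φ₂ s) (h' : (u', v') ∈ drsOracle γ φ₁ φ₂ s') {a b a' b' : ℝ}
    (ha : φ₁ u = a) (hb : φ₂ v = b) (ha' : φ₁ u' = a') (hb' : φ₂ v' = b') :
    dreReal γ a' b' s' u' v' ≤ dreReal γ a b s u v +
      2 * ‖u - v‖ / (γ * (1 - γ * L)) * ‖s' - s‖ + 1 / (γ * (1 - γ * L) ^ 2) * ‖s' - s‖ ^ 2 := by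
  have h0 := smooth_mul_dreReal_sub_le (s := s) hφ hγ h' ha hb ha' hb'
  have hG := gradient_residual_norm_le hφ hf hL hγ h.1 h'.1
  have hD := neg_le_mul_bregman (u := u) hφ hf hL hγ h'.1
  simp only at hG hD
  set δ := u' - u with hδ
  set G := (s' - u') - (s - u) with hGdef
  have hα1 : 0 < 1 - γ * L := by linarith
  -- Since `s' - s = δ + G` and `‖G‖ ≤ γL‖δ‖` with `γL < 1`, this `t` bounds both `‖δ‖` and `‖G‖`.
  set t := ‖s' - s‖ / (1 - γ * L) with ht
  have hδt : ‖δ‖ ≤ t := by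
    rw [ht, le_div_iff₀ hα1]
    have h1 : s' - s = δ + G := by rw [hδ, hGdef]; abel
    have h2 : ‖δ‖ ≤ ‖s' - s‖ + ‖G‖ := by
      have := norm_sub_le (s' - s) G
      rwa [h1, add_sub_cancel_right, ← h1] at this
    linarith
  have hGt : ‖G‖ ≤ t := by
    have : γ * L * ‖δ‖ ≤ 1 * ‖δ‖ := by gcongr
    linarith
  have h1 := (le_abs_self _).trans (abs_inner_sub_le_of_norm_le (r := u - v) hδt hGt)
  have h2 : γ * L / 2 * ‖δ‖ ^ 2 ≤ 1 / 2 * ‖δ‖ ^ 2 := by gcongr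
  have h3 : ‖δ‖ ^ 2 ≤ t ^ 2 := by gcongr
  have h4 : γ * (dreReal γ a' b' s' u' v' - dreReal γ a b s u v) ≤
      γ * (2 * ‖u - v‖ / (γ * (1 - γ * L)) * ‖s' - s‖ +
        1 / (γ * (1 - γ * L) ^ 2) * ‖s' - s‖ ^ 2) := by
    have e : γ * (2 * ‖u - v‖ / (γ * (1 - γ * L)) * ‖s' - s‖ +
        1 / (γ * (1 - γ * L) ^ 2) * ‖s' - s‖ ^ 2) = ‖u - v‖ * (2 * t) + t ^ 2 := by
      rw [ht]
      field_simp
    rw [e]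
    linarith
  linarith [le_of_mul_le_mul_left h4 hγ]

open Classical in
theorem smooth_dreReal_nominalStep_le (hφ : ∀ x, φ₁ x = (f x : EReal)) (hf : Differentiable ℝ f)
    (hL : LipschitzWith L (gradient f)) (hγ : 0 < γ) {lam : ℝ} (hlam : 0 < lam)
    (hα : γ * L < if ExtConvex φ₁ then 1 else (2 - lam) / 2)
    (hC : 0 ≤ decreaseConst (ExtConvex φ₁) (γ * L) lam)
    (h : (u, v) ∈ drsOracle γ φ₁ φ₂ s)
    (h' : (u', v') ∈ drsOracle γ φ₁ φ₂ (nominalStep lam s u v)) {a b a' b' : ℝ}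
    (ha : φ₁ u = a) (hb : φ₂ v = b) (ha' : φ₁ u' = a') (hb' : φ₂ v' = b') :
    dreReal γ a' b' (nominalStep lam s u v) u' v' ≤ dreReal γ a b s u v -
      decreaseConst (ExtConvex φ₁) (γ * L) lam / γ * ‖u - v‖ ^ 2 := by
  have h0 := smooth_mul_dreReal_sub_le (s := s) hφ hγ h' ha hb ha' hb'
  have hG := gradient_residual_norm_le hφ hf hL hγ h.1 h'.1
  have hα0 : 0 ≤ γ * L := mul_nonneg hγ.le L.2
  have hD : ‖(nominalStep lam s u v - u') - (s - u)‖ ^ 2 ≤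
      lam * (γ * (f u - f u') - inner ℝ (nominalStep lam s u v - u') (u - u')) +
      γ * L * (if ExtConvex φ₁ then max (γ * L - lam / 2) 0 else 1) * ‖u' - u‖ ^ 2 := by
    by_cases hcvx : ExtConvex φ₁
    · obtain ⟨h1, h2⟩ := gradient_residual_cocoercive hφ hf hL hγ hcvx h.1 h'.1
      exact norm_sq_le_of_cocoercive hcvx hlam h1 hG h2
    · rw [if_neg hcvx] at hα
      exact norm_sq_le_of_weakly_convex hcvx hα0 hlam hα.le hG (neg_le_mul_bregman hφ hf hL hγ h'.1)
  have hsum : (u' - u) + ((nominalStep lam s u v - u') - (s - u)) = -(lam • (u - v)) := by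
    rw [nominalStep]; abel
  have hquad := decreaseConst_mul_norm_sq_le (ExtConvex φ₁) hα0 hlam hC hG hD
  obtain ⟨h1, h2⟩ := inner_sub_of_add_eq_neg_smul hlam hsum
  simp only at hquad
  rw [h2] at hquad
  rw [h1] at h0
  have h3 : γ * dreReal γ a' b' (nominalStep lam s u v) u' v' ≤ γ * (dreReal γ a b s u v -
      decreaseConst (ExtConvex φ₁) (γ * L) lam / γ * ‖u - v‖ ^ 2) := by
    have e : γ * (decreaseConst (ExtConvex φ₁) (γ * L) lam / γ * ‖u - v‖ ^ 2) =
        decreaseConst (ExtConvex φ₁) (γ * L) lam * ‖u - v‖ ^ 2 := by field_simp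
    rw [mul_sub, e]
    linarith
  exact le_of_mul_le_mul_left h3 hγ

/-- By the descent lemma and `γL < 1`, the envelope dominates `φ v`. -/
theorem smooth_le_dreReal (hφ : ∀ x, φ₁ x = (f x : EReal)) (hf : Differentiable ℝ f)
    (hL : LipschitzWith L (gradient f)) (hγ : 0 < γ) (hα : γ * L < 1)
    {m : ℝ} (hm : ∀ x, (m : EReal) ≤ φ₁ x + φ₂ x)
    (h : (u, v) ∈ drsOracle γ φ₁ φ₂ s) {a b : ℝ} (ha : φ₁ u = a) (hb : φ₂ v = b) :
    m ≤ dreReal γ a b s u v := by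
  rw [hφ] at ha
  rw [← EReal.coe_eq_coe_iff.1 ha]
  have h1 : m ≤ f v + b := by
    have := hm v
    rw [hφ, hb] at this
    exact_mod_cast this
  have h2 := mul_le_mul_of_nonneg_left (le_add_inner_gradient_add_sq hf hL u v) hγ.le
  have h3 : γ * inner ℝ (gradient f u) (v - u) = inner ℝ (s - u) (v - u) := by
    rw [← smul_gradient_eq_of_mem_proxSet hφ hf hγ h.1, real_inner_smul_left]
  have h4 : γ * L * ‖v - u‖ ^ 2 ≤ 1 * ‖v - u‖ ^ 2 := by gcongr
  refine h1.trans (le_of_mul_le_mul_left ?_ hγ)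
  rw [mul_dreReal hγ]
  linarith

/-- The output of the algorithm in the smooth setting is almost stationary. -/
theorem smooth_output (hφ : ∀ x, φ₁ x = (f x : EReal)) (hf : Differentiable ℝ f)
    (hL : LipschitzWith L (gradient f)) (hγ : 0 < γ) (hα : γ * L < 1) (hb₂ : ∀ x, φ₂ x ≠ ⊥)
    (h : (u, v) ∈ drsOracle γ φ₁ φ₂ s) :
    ∃ ξ ∈ regSubdiff (fun x => φ₁ x + φ₂ x) v, ‖ξ‖ ≤ 2 * (1 / γ * ‖u - v‖) := by
  obtain ⟨b, hb⟩ := exists_coe_of_mem_proxSet hb₂ h.2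
  simp only at hb
  -- As `s - u = γ∇f(u)`, this vector equals `(∇f v - ∇f u) + (u - v)/γ`. Each summand has norm at
  -- most `‖u - v‖/γ`, hence the factor `2`.
  refine ⟨gradient f v + (1 / γ) • ((2 : ℝ) • u - s - v),
    mem_regSubdiff_of_quadratic_minorant (a := f v + b) (by rw [hφ, hb, EReal.coe_add])
      (L / 2 + 1 / (2 * γ)) fun y => ?_, ?_⟩
  · refine EReal.coe_le_of_forall_coe (EReal.add_ne_bot_iff.2 ⟨by simp [hφ], hb₂ y⟩) fun c hc => ?_
    have h2 := quadratic_minorant_of_mem_proxSet hb₂ hγ h.2 hb y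
    rw [hφ] at hc
    have h1 := add_inner_gradient_sub_sq_le hf hL v y
    generalize φ₂ y = z at hc h2
    induction z with
    | bot => exact absurd (le_bot_iff.1 h2) (EReal.coe_ne_bot _)
    | coe z =>
      have h3 : b + inner ℝ ((1 / γ) • ((2 : ℝ) • u - s - v)) (y - v) -
          1 / (2 * γ) * ‖y - v‖ ^ 2 ≤ z := by exact_mod_cast h2
      have h4 : f y + z = c := by exact_mod_cast hc
      rw [inner_add_left]
      linarith
    | top => simp at hc
  · have h1 : gradient f v + (1 / γ) • ((2 : ℝ) • u - s - v) =
        (gradient f v - gradient f u) + (1 / γ) • (u - v) := by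
      have h2 : (1 / γ) • (s - u) = gradient f u := by
        rw [← smul_gradient_eq_of_mem_proxSet hφ hf hγ h.1, smul_smul, one_div_mul_cancel hγ.ne',
          one_smul]
      rw [← h2, two_smul]
      simp only [smul_sub, smul_add]
      abel
    rw [h1]
    refine (norm_add_le _ _).trans ?_
    rw [norm_smul, Real.norm_of_nonneg (by positivity)]
    have h2 := hL.norm_sub_le v u
    rw [norm_sub_rev v u] at h2
    have h3 : (L : ℝ) ≤ 1 / γ := by
      rw [le_div_iff₀ hγ]
      linarith
    have h4 : L * ‖u - v‖ ≤ 1 / γ * ‖u - v‖ := by gcongr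
    linarith

end Pair

theorem neg_sub_mul_norm_le_of_lipschitzWith_gradient [CompleteSpace E] {f : E → ℝ} {L : ℝ≥0}
    (hf : Differentiable ℝ f) (hL : LipschitzWith L (gradient f)) (w : E) :
    f 0 - ‖gradient f 0‖ * ‖w‖ - L / 2 * ‖w‖ ^ 2 ≤ f w ∧
      f w ≤ f 0 + ‖gradient f 0‖ * ‖w‖ + L / 2 * ‖w‖ ^ 2 := by
  have h1 := add_inner_gradient_sub_sq_le hf hL 0 w
  have h2 := le_add_inner_gradient_add_sq hf hL 0 w
  have h3 := abs_le.1 (abs_real_inner_le_norm (gradient f 0) w)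
  rw [sub_zero] at h1 h2
  constructor <;> linarith

theorem smooth_drsOracle_nonempty [ProperSpace E] {φ₁ φ₂ : E → EReal} {f : E → ℝ} {L : ℝ≥0}
    {γ m : ℝ} (hφ : ∀ x, φ₁ x = (f x : EReal)) (hf : Differentiable ℝ f)
    (hL : LipschitzWith L (gradient f)) (hγ : 0 < γ) (hα : γ * L < 1) (hprop : IsProper φ₂)
    (hlsc : LowerSemicontinuous φ₂) (hm : ∀ x, (m : EReal) ≤ φ₁ x + φ₂ x) (s : E) :
    (drsOracle γ φ₁ φ₂ s).Nonempty := by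
  have hc : (L : ℝ) / 2 < 1 / (2 * γ) := by
    rw [lt_div_iff₀ (by positivity)]
    linarith
  have hlsc₁ : LowerSemicontinuous φ₁ := by
    rw [funext hφ]
    exact lowerSemicontinuous_coe hf.continuous
  have hprop₁ : IsProper φ₁ :=
    ⟨fun x => by simp [hφ], 0, show φ₁ 0 < ⊤ by rw [hφ]; exact EReal.coe_lt_top _⟩
  obtain ⟨u, hu⟩ := proxSet_nonempty hlsc₁ hprop₁ (a := -f 0) (b := ‖gradient f 0‖) hc
    (fun w => by
      rw [hφ, neg_neg]
      exact_mod_cast (neg_sub_mul_norm_le_of_lipschitzWith_gradient hf hL w).1) hγ s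
  -- The quadratic minorant of `φ₂` comes from `φ₂ ≥ m - f` and the quadratic upper bound on `f`.
  obtain ⟨v, hv⟩ := proxSet_nonempty hlsc hprop (a := f 0 - m) (b := ‖gradient f 0‖) hc
    (fun w => EReal.coe_le_of_forall_coe (hprop.1 w) fun b hb => by
      have h1 := hm w
      rw [hφ, hb] at h1
      have h2 : m ≤ f w + b := by exact_mod_cast h1
      linarith [(neg_sub_mul_norm_le_of_lipschitzWith_gradient hf hL w).2])
    hγ ((2 : ℝ) • u - s)
  exact ⟨(u, v), hu, hv⟩

theorem LSParams.SmoothInit.step_lt_one [CompleteSpace E] {P : LSParams} {φ₁ φ₂ : E → EReal}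
    {L : ℝ≥0} (hP : P.Admissible) (h : P.SmoothInit φ₁ φ₂ L) : P.γ * L < 1 := by
  refine h.stepsize.trans_le ?_
  have := hP.lam_pos
  split_ifs
  · exact le_rfl
  · linarith

theorem LSParams.SmoothInit.exists_meritFunction [ProperSpace E] {P : LSParams}
    {φ₁ φ₂ : E → EReal} {L : ℝ≥0} (hP : P.Admissible) (h : P.SmoothInit φ₁ φ₂ L) :
    ∃ (dre : E → ℝ) (m : ℝ), (∀ s u v, (u, v) ∈ drsOracle P.γ φ₁ φ₂ s →
        dreValue P.γ φ₁ φ₂ s u v = (dre s : EReal)) ∧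
      IsLeast (Set.range fun x => φ₁ x + φ₂ x) (m : EReal) ∧
      MeritFunction P φ₁ φ₂ (fun s => P.π * dre s) (P.π * m) := by
  have hα := h.step_lt_one hP
  obtain ⟨f, hφ, hf, hL⟩ := h.setting.smooth
  have hb₁ : ∀ x, φ₁ x ≠ ⊥ := fun x => by simp [hφ]
  have hb₂ := h.setting.ne_bot
  obtain ⟨x, hx, hmin⟩ := h.setting.solvable
  have hx₂ : φ₂ x < ⊤ := lt_top_iff_ne_top.2 fun ht => by simp [ht, hφ] at hx
  obtain ⟨m, hm⟩ := EReal.exists_coe_of_ne_bot_of_lt_top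
    (EReal.add_ne_bot_iff.2 ⟨hb₁ x, hb₂ x⟩) hx
  have hlow : ∀ y, (m : EReal) ≤ φ₁ y + φ₂ y := fun y => hm ▸ hmin y
  have hC := h.c_lt
  obtain ⟨dre, hdre, M⟩ := _root_.exists_meritFunction (P := P) (m := m) hb₁ hb₂
    (by simp [h.sign])
    (smooth_drsOracle_nonempty hφ hf hL hP.γ_pos hα ⟨hb₂, x, hx₂⟩ h.setting.lsc hlow) hC
    (fun s u v hq a b ha hb => ⟨_, _, fun s' u' v' hq' a' b' ha' hb' => by
      rw [h.sign, one_mul, one_mul]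
      exact smooth_dreReal_le_add hφ hf hL hP.γ_pos hα hq hq' ha hb ha' hb'⟩)
    (fun s u v hq a b ha hb u' v' hq' a' b' ha' hb' => by
      rw [h.sign, one_mul, one_mul]
      exact smooth_dreReal_nominalStep_le hφ hf hL hP.γ_pos hP.lam_pos h.stepsize
        (hP.c_pos.le.trans hC.le) hq hq' ha hb ha' hb')
    (fun s u v hq a b ha hb => by
      rw [h.sign, one_mul, one_mul]
      exact smooth_le_dreReal hφ hf hL hP.γ_pos hα hlow hq ha hb)
  refine ⟨dre, m, hdre, ⟨⟨x, hm⟩, ?_⟩, M⟩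
  rintro _ ⟨y, rfl⟩
  exact hlow y

end Smooth

/-! ### The strongly convex setting -/

theorem lowerSemicontinuous_sub_coe {X : Type*} [TopologicalSpace X] {h : X → EReal} (hlsc : LowerSemicontinuous h)
    (hb : ∀ x, h x ≠ ⊥) {q : X → ℝ} (hq : Continuous q) :
    LowerSemicontinuous fun x => h x - (q x : EReal) := by
  simp only [sub_eq_add_neg, ← EReal.coe_neg]
  exact lowerSemicontinuous_add_of_ne_bot hlsc (lowerSemicontinuous_coe hq.neg) hb
    fun x => EReal.coe_ne_bot _

section StronglyConvex

variable {E : Type*} [NormedAddCommGroup E] [InnerProductSpace ℝ E]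

section Pair

variable {φ₁ φ₂ : E → EReal} {μ γ : ℝ} {s u v s' u' v' : E} {a b a' b' : ℝ}

theorem ExtStronglyConvex.mul_norm_sq_le_bregman (hμ : ExtStronglyConvex μ φ₁) (hγ : 0 < γ)
    (h : u ∈ proxSet γ φ₁ s) (ha : φ₁ u = a) (ha' : φ₁ u' = a') :
    γ * μ / 2 * ‖u' - u‖ ^ 2 ≤ γ * (a' - a) - inner ℝ (s - u) (u' - u) := by
  have h1 := mul_le_mul_of_nonneg_left (hμ.subgradient_of_mem_proxSet h ha ha') hγ.le
  have e : γ * (1 / γ * inner ℝ (s - u) (u' - u)) = inner ℝ (s - u) (u' - u) := by field_simp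
  rw [mul_add, mul_add, e] at h1
  linarith

/-- Strong monotonicity of the subdifferential. -/
theorem ExtStronglyConvex.mul_norm_sq_le_inner (hμ : ExtStronglyConvex μ φ₁) (hγ : 0 < γ)
    (h : u ∈ proxSet γ φ₁ s) (h' : u' ∈ proxSet γ φ₁ s') (ha : φ₁ u = a) (ha' : φ₁ u' = a') :
    γ * μ * ‖u' - u‖ ^ 2 ≤ inner ℝ (u' - u) ((s' - u') - (s - u)) := by
  have h1 := hμ.mul_norm_sq_le_bregman hγ h ha ha'
  have h2 := hμ.mul_norm_sq_le_bregman hγ h' ha' ha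
  rw [norm_sub_rev u u', ← neg_sub u' u, inner_neg_right] at h2
  rw [inner_sub_right, real_inner_comm, real_inner_comm (s - u)]
  linarith

theorem stronglyConvex_le_mul_dreReal_sub (hcvx : ExtConvex φ₂) (hγ : 0 < γ)
    (h : (u, v) ∈ drsOracle γ φ₁ φ₂ s) (hb : φ₂ v = b) (hb' : φ₂ v' = b') :
    (γ * (a' - a) - inner ℝ (s - u) (u' - u)) +
        inner ℝ (u - v) ((u' - u) - ((s' - u') - (s - u))) -
        1 / 2 * ‖(s' - u') - (s - u)‖ ^ 2 ≤
      γ * (dreReal γ a' b' s' u' v' - dreReal γ a b s u v) := by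
  refine le_mul_dreReal_sub hγ ?_
  have := hcvx.extStronglyConvex_zero.subgradient_of_mem_proxSet h.2 hb hb'
  simpa using this

theorem stronglyConvex_neg_dreReal_le_add (hμ : ExtStronglyConvex μ φ₁) (hμ0 : 0 < μ)
    (hcvx : ExtConvex φ₂) (hγ : 0 < γ)
    (h : (u, v) ∈ drsOracle γ φ₁ φ₂ s) (h' : (u', v') ∈ drsOracle γ φ₁ φ₂ s')
    (ha : φ₁ u = a) (hb : φ₂ v = b) (ha' : φ₁ u' = a') (hb' : φ₂ v' = b') :
    -dreReal γ a' b' s' u' v' ≤ -dreReal γ a b s u v +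
      2 * ‖u - v‖ / γ * ‖s' - s‖ + 1 / (2 * γ) * ‖s' - s‖ ^ 2 := by
  have h0 := stronglyConvex_le_mul_dreReal_sub (a := a) (a' := a') (u' := u') (s' := s')
    hcvx hγ h hb hb'
  have hD := hμ.mul_norm_sq_le_bregman hγ h.1 ha ha'
  have hI := hμ.mul_norm_sq_le_inner hγ h.1 h'.1 ha ha'
  simp only at hI hD
  set δ := u' - u with hδ
  set G := (s' - u') - (s - u) with hGdef
  have hI0 : 0 ≤ inner ℝ δ G := le_trans (by positivity) hI
  have hD0 : 0 ≤ γ * (a' - a) - inner ℝ (s - u) δ := le_trans (by positivity) hD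
  -- Monotonicity makes the cross term nonnegative, so both `δ` and `G` are at most as long as `s' -
  -- s`.
  have hsq : ‖s' - s‖ ^ 2 = ‖δ‖ ^ 2 + 2 * inner ℝ δ G + ‖G‖ ^ 2 := by
    rw [← norm_add_sq_real, hδ, hGdef]
    congr 2
    abel
  have hδt : ‖δ‖ ≤ ‖s' - s‖ := by
    refine le_of_sq_le_sq ?_ (norm_nonneg _)
    linarith [sq_nonneg ‖G‖]
  have hGt : ‖G‖ ≤ ‖s' - s‖ := by
    refine le_of_sq_le_sq ?_ (norm_nonneg _)
    linarith [sq_nonneg ‖δ‖]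
  have h1 := (neg_abs_le _).trans' (neg_le_neg (abs_inner_sub_le_of_norm_le (r := u - v) hδt hGt))
  have h2 : ‖G‖ ^ 2 ≤ ‖s' - s‖ ^ 2 := by gcongr
  have h3 : γ * (dreReal γ a b s u v - dreReal γ a' b' s' u' v') ≤
      γ * (2 * ‖u - v‖ / γ * ‖s' - s‖ + 1 / (2 * γ) * ‖s' - s‖ ^ 2) := by
    have e : γ * (2 * ‖u - v‖ / γ * ‖s' - s‖ + 1 / (2 * γ) * ‖s' - s‖ ^ 2) =
        ‖u - v‖ * (2 * ‖s' - s‖) + 1 / 2 * ‖s' - s‖ ^ 2 := by field_simp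
    rw [e]
    linarith
  linarith [le_of_mul_le_mul_left h3 hγ]

/-- Strong convexity of `φ₁` bounds `δ` by `G` as a `1/μ`-Lipschitz gradient of a convex function
would, with `α = 1/(γμ)`. The quadratic estimate applies with the roles of `δ` and `G` exchanged. -/
theorem stronglyConvex_neg_dreReal_nominalStep_le (hμ : ExtStronglyConvex μ φ₁) (hμ0 : 0 < μ)
    (hcvx : ExtConvex φ₂) (hγ : 0 < γ) {lam : ℝ} (hlam : 0 < lam)
    (hC : 0 ≤ decreaseConst True (1 / (γ * μ)) lam)
    (h : (u, v) ∈ drsOracle γ φ₁ φ₂ s)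
    (h' : (u', v') ∈ drsOracle γ φ₁ φ₂ (nominalStep lam s u v))
    (ha : φ₁ u = a) (hb : φ₂ v = b) (ha' : φ₁ u' = a') (hb' : φ₂ v' = b') :
    -dreReal γ a' b' (nominalStep lam s u v) u' v' ≤ -dreReal γ a b s u v -
      decreaseConst True (1 / (γ * μ)) lam / γ * ‖u - v‖ ^ 2 := by
  have h0 := stronglyConvex_le_mul_dreReal_sub (a := a) (a' := a') (u' := u')
    (s' := nominalStep lam s u v) hcvx hγ h hb hb'
  have hD := hμ.mul_norm_sq_le_bregman hγ h.1 ha ha'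
  have hI := hμ.mul_norm_sq_le_inner hγ h.1 h'.1 ha ha'
  have hsum : (u' - u) + ((nominalStep lam s u v - u') - (s - u)) = -(lam • (u - v)) := by
    rw [nominalStep]; abel
  simp only at hI hD
  set δ := u' - u with hδ
  set G := (nominalStep lam s u v - u') - (s - u) with hGdef
  have hγμ : 0 < γ * μ := by positivity
  have hnorm : ‖δ‖ ≤ 1 / (γ * μ) * ‖G‖ := by
    rcases eq_or_lt_of_le (norm_nonneg δ) with hz | hpos
    · rw [← hz]
      positivity
    · rw [one_div, le_inv_mul_iff₀ hγμ]
      refine le_of_mul_le_mul_right ?_ hpos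
      linarith [real_inner_le_norm δ G]
  have hcoco : ‖δ‖ ^ 2 ≤ 2 * (1 / (γ * μ)) * (γ * (a' - a) - inner ℝ (s - u) δ) := by
    have := mul_le_mul_of_nonneg_left hD (a := 2 * (1 / (γ * μ))) (by positivity)
    have e : 2 * (1 / (γ * μ)) * (γ * μ / 2 * ‖δ‖ ^ 2) = ‖δ‖ ^ 2 := by field_simp
    rwa [e] at this
  have hD0 : 0 ≤ γ * (a' - a) - inner ℝ (s - u) δ := le_trans (by positivity) hD
  have hα0 : 0 ≤ 1 / (γ * μ) := by positivity
  have hquad := decreaseConst_mul_norm_sq_le True hα0 hlam hC hnorm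
    (norm_sq_le_of_cocoercive trivial hlam hD0 hnorm hcoco)
  obtain ⟨h1, h2⟩ := inner_sub_of_add_eq_neg_smul hlam hsum
  rw [add_comm G δ, h2] at hquad
  rw [h1] at h0
  have h3 : γ * -dreReal γ a' b' (nominalStep lam s u v) u' v' ≤ γ * (-dreReal γ a b s u v -
      decreaseConst True (1 / (γ * μ)) lam / γ * ‖u - v‖ ^ 2) := by
    have e : γ * (decreaseConst True (1 / (γ * μ)) lam / γ * ‖u - v‖ ^ 2) =
        decreaseConst True (1 / (γ * μ)) lam * ‖u - v‖ ^ 2 := by field_simp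
    rw [mul_sub, e]
    linarith
  exact le_of_mul_le_mul_left h3 hγ

/-- Adding the subgradient inequalities of `φ₁` at `u` and `φ₂` at `v`, both tested at `x`, leaves a
surplus of `½‖x - v‖²` once `γμ ≥ 1`. -/
theorem stronglyConvex_dreReal_le (hμ : ExtStronglyConvex μ φ₁) (hcvx : ExtConvex φ₂) (hγ : 0 < γ)
    (hγμ : 1 ≤ γ * μ) (h : (u, v) ∈ drsOracle γ φ₁ φ₂ s) (ha : φ₁ u = a) (hb : φ₂ v = b) {x : E}
    (ha' : φ₁ x = a') (hb' : φ₂ x = b') : dreReal γ a b s u v ≤ a' + b' := by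
  have h1 := hμ.mul_norm_sq_le_bregman hγ h.1 ha ha'
  have h2 := hcvx.extStronglyConvex_zero.mul_norm_sq_le_bregman hγ h.2 hb hb'
  have h3 : 1 / 2 * ‖x - u‖ ^ 2 ≤ γ * μ / 2 * ‖x - u‖ ^ 2 := by gcongr
  have h4 : 0 ≤ ‖x - v‖ ^ 2 := by positivity
  have h5 := h3.trans h1
  refine le_of_mul_le_mul_left ?_ hγ
  rw [mul_dreReal hγ]
  simp only [mul_zero, zero_div, zero_mul] at h2
  simp only [← real_inner_self_eq_norm_sq, inner_sub_left, inner_sub_right, real_inner_smul_right,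
    real_inner_comm] at h2 h4 h5 ⊢
  linarith

end Pair

theorem mem_limSubdiff_of_mem_proxSet {h : E → EReal} (hb : ∀ x, h x ≠ ⊥) {γ : ℝ} (hγ : 0 < γ)
    {s u : E} (hu : u ∈ proxSet γ h s) : (1 / γ) • (s - u) ∈ limSubdiff h u := by
  obtain ⟨a, ha⟩ := exists_coe_of_mem_proxSet hb hu
  exact regSubdiff_subset_limSubdiff h u (mem_regSubdiff_of_quadratic_minorant ha _
    (quadratic_minorant_of_mem_proxSet hb hγ hu ha))

variable [ProperSpace E] {φ₁ φ₂ : E → EReal} {μ : ℝ}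

theorem StronglyConvexSetting.exists_minorant (h : StronglyConvexSetting φ₁ φ₂ μ) :
    ∃ a b : ℝ, ∀ w, ((-a - b * ‖w‖ : ℝ) : EReal) ≤ φ₁ w - ((μ / 2 * ‖w‖ ^ 2 : ℝ) : EReal) := by
  refine ExtConvex.exists_linear_minorant h.strong
    (lowerSemicontinuous_sub_coe h.lsc₁ h.proper₁.1 (by fun_prop)) ⟨fun x hx => ?_, ?_⟩
  · simp only [sub_eq_add_neg, ← EReal.coe_neg, EReal.add_eq_bot_iff] at hx
    exact hx.elim (h.proper₁.1 x) (EReal.coe_ne_bot _)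
  · obtain ⟨x, hx⟩ := h.proper₁.2
    obtain ⟨c, hc⟩ := EReal.exists_coe_of_ne_bot_of_lt_top (h.proper₁.1 x) hx
    refine ⟨x, show φ₁ x - ((μ / 2 * ‖x‖ ^ 2 : ℝ) : EReal) < ⊤ from ?_⟩
    rw [hc, ← EReal.coe_sub]
    exact EReal.coe_lt_top _

theorem StronglyConvexSetting.drsOracle_nonempty (h : StronglyConvexSetting φ₁ φ₂ μ) {γ : ℝ}
    (hγ : 0 < γ) (s : E) : (drsOracle γ φ₁ φ₂ s).Nonempty := by
  have hc : (0 : ℝ) < 1 / (2 * γ) := by positivity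
  obtain ⟨a, b, hab⟩ := h.exists_minorant
  obtain ⟨a', b', hab'⟩ := h.convex₂.exists_linear_minorant h.lsc₂ h.proper₂
  obtain ⟨u, hu⟩ := proxSet_nonempty h.lsc₁ h.proper₁ (a := a) (b := b) hc (fun w =>
    EReal.coe_le_of_forall_coe (h.proper₁.1 w) fun c hc => by
      have h1 := hab w
      rw [hc] at h1
      have h2 : -a - b * ‖w‖ ≤ c - μ / 2 * ‖w‖ ^ 2 := by exact_mod_cast h1
      have h3 : 0 ≤ μ / 2 * ‖w‖ ^ 2 := mul_nonneg (by linarith [h.pos]) (sq_nonneg _)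
      linarith) hγ s
  obtain ⟨v, hv⟩ := proxSet_nonempty h.lsc₂ h.proper₂ (a := a') (b := b') hc (fun w => by
    simpa using hab' w) hγ ((2 : ℝ) • u - s)
  exact ⟨(u, v), hu, hv⟩

theorem StronglyConvexSetting.exists_minimizer (h : StronglyConvexSetting φ₁ φ₂ μ) :
    (argminSet fun x => φ₁ x + φ₂ x).Nonempty := by
  have hμ := h.pos
  obtain ⟨a, b, hab⟩ := h.exists_minorant
  obtain ⟨a', b', hab'⟩ := h.convex₂.exists_linear_minorant h.lsc₂ h.proper₂
  obtain ⟨x, hx₁, y, hy₂, hxy⟩ := intrinsicInterior_subset h.relint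
  obtain rfl : x = y := sub_eq_zero.1 hxy
  set k : E → EReal := fun w => φ₁ w - ((μ / 2 * ‖w‖ ^ 2 : ℝ) : EReal) with hk
  have hkb : ∀ w, k w ≠ ⊥ := fun w hw => by
    have := hab w
    simp only [hk] at hw
    rw [hw] at this
    exact EReal.coe_ne_bot _ (le_bot_iff.1 this)
  -- Minimizing `φ₁ + φ₂ = (k + φ₂) + μ/2 ‖·‖²` is the proximal problem of `k + φ₂` at `0` with
  -- stepsize `1/μ`, and `k + φ₂` has a linear minorant.
  obtain ⟨z, hz⟩ := proxSet_nonempty (h := fun w => k w + φ₂ w) (γ := 1 / μ) (a := a + a')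
    (b := b + b') (c := 0)
    (lowerSemicontinuous_add_of_ne_bot
      (lowerSemicontinuous_sub_coe h.lsc₁ h.proper₁.1 (by fun_prop)) h.lsc₂ hkb h.proper₂.1)
    ⟨fun w => EReal.add_ne_bot_iff.2 ⟨hkb w, h.proper₂.1 w⟩, x, by
      obtain ⟨c, hc⟩ := EReal.exists_coe_of_ne_bot_of_lt_top (h.proper₁.1 x) hx₁
      refine EReal.add_lt_top ?_ hy₂.ne
      simp only [hk]
      rw [hc, ← EReal.coe_sub]
      exact EReal.coe_ne_top _⟩
    (by positivity)
    (fun w => by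
      refine le_trans (le_of_eq ?_) (add_le_add (hab w) (hab' w))
      rw [← EReal.coe_add]
      congr 1
      ring) (by positivity) 0
  have heq : (fun w => k w + φ₂ w + ((1 / (2 * (1 / μ)) * ‖w - 0‖ ^ 2 : ℝ) : EReal)) =
      fun w => φ₁ w + φ₂ w := by
    funext w
    have e : 1 / (2 * (1 / μ)) * ‖w - 0‖ ^ 2 = μ / 2 * ‖w‖ ^ 2 := by
      rw [sub_zero]
      field_simp
    rw [e, add_right_comm]
    simp only [hk]
    rw [EReal.sub_add_cancel]
  rw [proxSet, heq] at hz
  exact ⟨z, hz⟩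

theorem LSParams.StronglyConvexInit.exists_meritFunction {P : LSParams} (hP : P.Admissible)
    (h : P.StronglyConvexInit φ₁ φ₂ μ) :
    ∃ (dre : E → ℝ) (m : ℝ), (∀ s u v, (u, v) ∈ drsOracle P.γ φ₁ φ₂ s →
        dreValue P.γ φ₁ φ₂ s u v = (dre s : EReal)) ∧
      IsLeast (Set.range fun x => φ₁ x + φ₂ x) (m : EReal) ∧
      MeritFunction P φ₁ φ₂ (fun s => P.π * dre s) (P.π * m) := by
  have hS := h.setting
  have hμ := hS.pos
  have hγ := hP.γ_pos
  have hb₁ := hS.proper₁.1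
  have hb₂ := hS.proper₂.1
  obtain ⟨x, hx, hmin⟩ := hS.exists_minimizer
  obtain ⟨a₀, ha₀⟩ := EReal.exists_coe_of_ne_bot_of_lt_top (hb₁ x) (lt_top_iff_ne_top.2 fun ht => by
    simp [ht, EReal.top_add_of_ne_bot (hb₂ x)] at hx)
  obtain ⟨b₀, hb₀⟩ := EReal.exists_coe_of_ne_bot_of_lt_top (hb₂ x) (lt_top_iff_ne_top.2 fun ht => by
    simp [ht, EReal.add_top_of_ne_bot (hb₁ x)] at hx)
  have hC := h.c_lt
  have hγμ : 1 ≤ P.γ * μ := by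
    have := h.stepsize
    rw [div_lt_iff₀ hμ] at this
    exact this.le
  obtain ⟨dre, hdre, M⟩ := _root_.exists_meritFunction (P := P) (m := a₀ + b₀) hb₁ hb₂
    (by simp [h.sign]) (hS.drsOracle_nonempty hγ) hC
    (fun s u v hq a b ha hb => ⟨_, _, fun s' u' v' hq' a' b' ha' hb' => by
      rw [h.sign, neg_one_mul, neg_one_mul]
      exact stronglyConvex_neg_dreReal_le_add hS.strong hμ hS.convex₂ hγ hq hq' ha hb ha' hb'⟩)
    (fun s u v hq a b ha hb u' v' hq' a' b' ha' hb' => by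
      rw [h.sign, neg_one_mul, neg_one_mul]
      exact stronglyConvex_neg_dreReal_nominalStep_le hS.strong hμ hS.convex₂ hγ hP.lam_pos
        (hP.c_pos.le.trans hC.le) hq hq' ha hb ha' hb')
    (fun s u v hq a b ha hb => by
      rw [h.sign, neg_one_mul, neg_one_mul]
      exact neg_le_neg (stronglyConvex_dreReal_le hS.strong hS.convex₂ hγ hγμ hq ha hb ha₀ hb₀))
  have hm : φ₁ x + φ₂ x = ((a₀ + b₀ : ℝ) : EReal) := by rw [ha₀, hb₀, EReal.coe_add]
  refine ⟨dre, a₀ + b₀, hdre, ⟨⟨x, hm⟩, ?_⟩, M⟩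
  rintro _ ⟨y, rfl⟩
  exact hm ▸ hmin y

end StronglyConvex

/-! ### The main theorem -/

theorem mainTheorem1 (p : ℕ) (φ₁ φ₂ : EuclideanSpace ℝ (Fin p) → EReal)
    (P : LSParams) (hP : P.Admissible)
    (hinit : (∃ L : ℝ≥0, P.SmoothInit φ₁ φ₂ L) ∨ (∃ μ : ℝ, P.StronglyConvexInit φ₁ φ₂ μ))
    (s₀ : EuclideanSpace ℝ (Fin p)) :
    -- the oracle is nonempty, so that the algorithm starts, and it never gets stuck
    (∀ s, (drsOracle P.γ φ₁ φ₂ s).Nonempty) ∧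
    (∀ σ, LSReachable P φ₁ φ₂ s₀ σ →
      (∃ σ', LSStep P φ₁ φ₂ σ σ') ∨ ∃ K s u v, σ = .done K s u v) ∧
    -- at every iteration, whatever the direction, the number of backtracks is finite
    (∀ k s u v d, LSReachable P φ₁ φ₂ s₀ (.trial k s u v d 1 0) →
      ∃ N : ℕ, ∀ τ i, Relation.ReflTransGen (LSStep P φ₁ φ₂)
        (.trial k s u v d 1 0) (.trial k s u v d τ i) → i ≤ N) ∧
    -- the algorithm terminates
    (¬ ∃ σ : ℕ → LSState (EuclideanSpace ℝ (Fin p)),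
      LSInit P φ₁ φ₂ s₀ (σ 0) ∧ ∀ n, LSStep P φ₁ φ₂ (σ n) (σ (n + 1))) ∧
    -- the envelope is a well-defined real-valued function, the minimum of `φ₁ + φ₂` is attained
    -- and real, and they bound the number of iterations
    (∃ (dre : EuclideanSpace ℝ (Fin p) → ℝ) (m : ℝ),
      (∀ s u v, (u, v) ∈ drsOracle P.γ φ₁ φ₂ s → dreValue P.γ φ₁ φ₂ s u v = (dre s : EReal)) ∧
      IsLeast (Set.range fun x => φ₁ x + φ₂ x) (m : EReal) ∧
      ∀ K s u v, LSReachable P φ₁ φ₂ s₀ (.done K s u v) →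
        (K : ℝ) ≤ |dre s₀ - m| / (P.c * P.γ * P.ε ^ 2)) ∧
    -- the output in the smooth setting
    ((∃ L : ℝ≥0, P.SmoothInit φ₁ φ₂ L) →
      ∀ K s u v, LSReachable P φ₁ φ₂ s₀ (.done K s u v) →
        (regSubdiff (fun x => φ₁ x + φ₂ x) v).Nonempty ∧
        Metric.infDist 0 (regSubdiff (fun x => φ₁ x + φ₂ x) v) ≤ 2 * P.ε) ∧
    -- the output in the strongly convex setting
    ((∃ μ : ℝ, P.StronglyConvexInit φ₁ φ₂ μ) →
      ∀ K s u v, LSReachable P φ₁ φ₂ s₀ (.done K s u v) →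
        -((1 / P.γ) • (u - s)) ∈ limSubdiff φ₁ u ∧
        (limSubdiff φ₂ v).Nonempty ∧
        Metric.infDist ((1 / P.γ) • (u - s)) (limSubdiff φ₂ v) ≤ P.ε ∧
        ‖u - v‖ ≤ P.γ * P.ε) := by
  obtain ⟨dre, m, hdre, hm, M⟩ : ∃ (dre : EuclideanSpace ℝ (Fin p) → ℝ) (m : ℝ),
      (∀ s u v, (u, v) ∈ drsOracle P.γ φ₁ φ₂ s →
        dreValue P.γ φ₁ φ₂ s u v = (dre s : EReal)) ∧
      IsLeast (Set.range fun x => φ₁ x + φ₂ x) (m : EReal) ∧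
      MeritFunction P φ₁ φ₂ (fun s => P.π * dre s) (P.π * m) := by
    rcases hinit with ⟨L, h⟩ | ⟨μ, h⟩
    · exact h.exists_meritFunction hP
    · exact h.exists_meritFunction hP
  have hπ : |P.π| = 1 := by
    rcases hinit with ⟨L, h⟩ | ⟨μ, h⟩ <;> simp [h.sign]
  have hγ := hP.γ_pos
  have hc := hP.c_pos
  have hε := hP.ε_pos
  refine ⟨M.nonempty, fun σ _ => M.exists_step σ, fun k s u v d hr => ?_, M.terminates hP s₀,
    ⟨dre, m, hdre, hm, fun K s u v hr => ?_⟩, ?_, ?_⟩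
  · obtain ⟨⟨hq, -⟩, hres⟩ := M.invariant_of_reachable hP hr
    exact M.backtracks_le hP d hq hres
  · obtain ⟨⟨-, hK⟩, -⟩ := M.invariant_of_reachable hP hr
    refine (M.iterations_le hP hK).trans ?_
    -- Since `|π| = 1`, the absolute value covers both signs.
    have : P.π * dre s₀ - P.π * m ≤ |dre s₀ - m| := by
      rw [← mul_sub, ← one_mul |dre s₀ - m|, ← hπ, ← abs_mul]
      exact le_abs_self _
    gcongr
  · rintro ⟨L, h⟩ K s u v hr
    obtain ⟨⟨hq, -⟩, hres⟩ := M.invariant_of_reachable hP hr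
    obtain ⟨f, hφ, hf, hL⟩ := h.setting.smooth
    obtain ⟨ξ, hξ, hle⟩ := smooth_output hφ hf hL hγ (h.step_lt_one hP) h.setting.ne_bot hq
    refine ⟨⟨ξ, hξ⟩, (Metric.infDist_le_dist_of_mem hξ).trans ?_⟩
    rw [dist_zero_left]
    linarith
  · rintro ⟨μ, h⟩ K s u v hr
    obtain ⟨⟨hq, -⟩, hres⟩ := M.invariant_of_reachable hP hr
    have h₁ := mem_limSubdiff_of_mem_proxSet h.setting.proper₁.1 hγ hq.1
    have h₂ := mem_limSubdiff_of_mem_proxSet h.setting.proper₂.1 hγ hq.2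
    refine ⟨?_, ⟨_, h₂⟩, (Metric.infDist_le_dist_of_mem h₂).trans ?_, ?_⟩
    · rwa [← smul_neg, neg_sub]
    -- The subgradient `(2u - s - v)/γ` of `φ₂` at `v` differs from `y = (u - s)/γ` by `(u - v)/γ`,
    -- the quantity in the stopping test.
    · have e : (1 / P.γ) • (u - s) - (1 / P.γ) • ((2 : ℝ) • u - s - v) =
          -((1 / P.γ) • (u - v)) := by
        rw [two_smul, ← smul_sub, ← smul_neg]
        congr 1
        abel
      rw [dist_eq_norm, e, norm_neg, norm_smul, Real.norm_of_nonneg (by positivity)]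
      exact hres
    · rwa [one_div, inv_mul_le_iff₀ hγ] at hres
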